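/- **Global minimum entropy principle.** Let $d\ge 1$. Let $h:(0,\infty)\to\mathbb R$ be a continuously differentiable Synge-type equation of state: for all $\theta>0$, $h(\theta)>\theta$ and $$h'(\theta)>\frac{h(\theta)}{h(\theta)-\theta},$$ and put $e(\theta)=h(\theta)-\theta-1$. For $\rho>0$, $p>0$, $v\in\mathbb R^d$ with $|v|<1$, put $\theta=p/\rho$, $h=h(\theta)$, $\gamma=(1-|v|^2)^{-1/2}$ and $$\mathbf U=(D,m,E)=(\rho\gamma,\ \rho h\gamma^2 v,\ \rho h\gamma^2-p),\qquad \mathbf F_i(\mathbf U)=(Dv_i,\ v_i m+p\,\mathbf e_i,\ m_i)\quad(i=1,\dots,d).$$ Let $\mathcal G\subset\mathbb R^{d+2}$ be the set of all such $\mathbf U$ (on $\mathcal G$ the quantities $\rho,v,p$ are functions of $\mathbf U$), and define the specific entropy on $\mathcal G$ by $$S(\mathbf U)=-\ln\rho+\int_1^{\theta}\frac{e'(\xi)}{\xi}\,d\xi .$$ A convex entropy pair is a convex function $\eta\in C^2(\mathcal G)$ together with $q_1,\dots,q_d\in C^1(\mathcal G)$ such that $q_i'(\mathbf U)=\eta'(\mathbf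 U)\,\mathbf F_i'(\mathbf U)$ on $\mathcal G$ for all $i$. Let $\mathbf U$ be an entropy solution of the relativistic Euler system $\partial_t\mathbf U+\sum_{i=1}^d\partial_{x_i}\mathbf F_i(\mathbf U)=0$ on $\mathbb R^d\times(0,\infty)$ with initial datum $\mathbf U(\cdot,0)$. That is: $\mathbf U$ and $\mathbf U(\cdot,0)$ take values in $\mathcal G$ almost everywhere; $\mathbf U$ and $\mathbf F_i(\mathbf U)$ are locally integrable on $\mathbb R^d\times[0,\infty)$ and $\mathbf U(\cdot,0)$ is locally integrable on $\mathbb R^d$; for all $\varphi\in C_c^\infty(\mathbb R^d\times\mathbb R)$, $$\int_0^\infty\!\!\int_{\mathbb R^d}\Big(\partial_t\varphi\,\mathbf U+\sum_{i=1}^d\partial_{x_i}\varphi\,\mathbf F_i(\mathbf U)\Big)dx\,dt+\int_{\mathbb R^d}\varphi(x,0)\,\mathbf U(x,0)\,dx=0;$$ and for every convex entropy pair $(\eta,q)$ the functions $\eta(\mathbf U)$, $q_i(\mathbf U)$ and $\eta(\mathbf U(\cdot,0))$ are locally integrable (on $\mathbb R^d\times[0,\infty)$, respectively $\mathbb R^d$)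 and, for all $0\le\varphi\in C_c^\infty(\mathbb R^d\times\mathbb R)$, $$\int_0^\infty\!\!\int_{\mathbb R^d}\Big(\partial_t\varphi\,\eta(\mathbf U)+\sum_{i=1}^d\partial_{x_i}\varphi\,q_i(\mathbf U)\Big)dx\,dt+\int_{\mathbb R^d}\varphi(x,0)\,\eta(\mathbf U(x,0))\,dx\ \ge 0 .$$ Then, writing $S(x,t)=S(\mathbf U(x,t))$, $$S(x,t)\ \ge\ \operatorname*{ess\,inf}_{y\in\mathbb R^d}S(y,0)\qquad\text{for almost every }x\in\mathbb R^d,$$ for almost every $t>0$, and moreover for every $t>0$ at which $\mathbf U$ is weakly continuous in time, i.e. such that $\mathbf U(\cdot,t)$ is locally integrable, $\mathbf U(x,t)\in\mathcal G$ for almost every $x$, and $\int_{\mathbb R^d}\psi(x)\,\mathbf U(x,s)\,dx\to\int_{\mathbb R^d}\psi(x)\,\mathbf U(x,t)\,dx$ as $s\to t$ for all $\psi\in C_c^\infty(\mathbb R^d)$. In particular it holds for all $t>0$ if the representative of $\mathbf U$ is weakly continuous in time on $(0,\infty)$. -/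

import Mathlib

open MeasureTheory Set Filter
open scoped Topology ContDiff

namespace RelEuler

/-- Points of the physical space `ℝᵈ`, with the Euclidean norm. -/
abbrev Space (d : ℕ) : Type := EuclideanSpace ℝ (Fin d)

/-- Vectors `(a, b, c)` of `ℝ × ℝᵈ × ℝ = ℝ^{d+2}`. They serve as primitive states `(ρ, v, p)`,
as conservative states `(D, m, E)` and as values of the fluxes. -/
abbrev State (d : ℕ) : Type := ℝ × Space d × ℝ

/-- Equations of state `h = h(θ)` of Synge type: continuously differentiable on `(0, ∞)`, with
`h'(θ) > h(θ) / (h(θ) - θ)`. Here `h(θ) - θ = 1 + e(θ)`, `e` being the specific internal energy;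
the field `lt_enthalpy` says that this total specific energy is positive. -/
structure IsSyngeType (h : ℝ → ℝ) : Prop where
  contDiffOn : ContDiffOn ℝ 1 h (Ioi 0)
  lt_enthalpy : ∀ θ : ℝ, 0 < θ → θ < h θ
  causal : ∀ θ : ℝ, 0 < θ → h θ / (h θ - θ) < deriv h θ

/-- The specific internal energy `e(θ) = h(θ) - θ - 1`. -/
noncomputable def internalEnergy (h : ℝ → ℝ) (θ : ℝ) : ℝ := h θ - θ - 1

/-- The Lorentz factor `γ = (1 - |v|²)^{-1/2}`. -/
noncomputable def lorentz {d : ℕ} (v : Space d) : ℝ := (√(1 - ‖v‖ ^ 2))⁻¹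

/-- Admissible primitive states `(ρ, v, p)`: `ρ > 0`, `|v| < 1`, `p > 0`. -/
def primAdmissible (d : ℕ) : Set (State d) := {V | 0 < V.1 ∧ ‖V.2.1‖ < 1 ∧ 0 < V.2.2}

/-- `(ρ, v, p) ↦ (D, m, E) = (ρ γ, ρ h γ² v, ρ h γ² - p)`, where `h = h(p / ρ)`. -/
noncomputable def primToCons {d : ℕ} (h : ℝ → ℝ) (V : State d) : State d :=
  (V.1 * lorentz V.2.1,
    (V.1 * h (V.2.2 / V.1) * lorentz V.2.1 ^ 2) • V.2.1,
    V.1 * h (V.2.2 / V.1) * lorentz V.2.1 ^ 2 - V.2.2)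

/-- The set `𝒢` of admissible conservative states: those that come from an admissible
primitive state. -/
def admissible (d : ℕ) (h : ℝ → ℝ) : Set (State d) := primToCons h '' primAdmissible d

/-- The primitive state `(ρ(U), v(U), p(U))` of an admissible conservative state `U`
(an arbitrary value outside `𝒢`). -/
noncomputable def consToPrim {d : ℕ} (h : ℝ → ℝ) (U : State d) : State d :=
  Function.invFunOn (primToCons h) (primAdmissible d) U

theorem consToPrim_mem {d : ℕ} {h : ℝ → ℝ} {U : State d} (hU : U ∈ admissible d h) :
    consToPrim h U ∈ primAdmissible d :=
  Function.invFunOn_mem hU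

theorem primToCons_consToPrim {d : ℕ} {h : ℝ → ℝ} {U : State d} (hU : U ∈ admissible d h) :
    primToCons h (consToPrim h U) = U :=
  Function.invFunOn_eq hU

/-- The flux `F_i(U) = (D v_i, v_i m + p e_i, m_i)`. -/
noncomputable def flux {d : ℕ} (h : ℝ → ℝ) (i : Fin d) (U : State d) : State d :=
  (U.1 * (consToPrim h U).2.1 i,
    (consToPrim h U).2.1 i • U.2.1 + (consToPrim h U).2.2 • EuclideanSpace.single i (1 : ℝ),
    U.2.1 i)

/-- The specific entropy `S(U) = -ln ρ + ∫_1^θ e'(ξ) / ξ dξ` with `θ = p / ρ`. -/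
noncomputable def specificEntropy {d : ℕ} (h : ℝ → ℝ) (U : State d) : ℝ :=
  -Real.log (consToPrim h U).1 +
    ∫ ξ in (1 : ℝ)..((consToPrim h U).2.2 / (consToPrim h U).1),
      deriv (internalEnergy h) ξ / ξ

/-- Convex entropy pairs `(η, q)` of the relativistic Euler system on `𝒢`: `η` is convex and of
class `C²`, `q` is of class `C¹`, and `q_i'(U) = η'(U) F_i'(U)` for all `i` and all `U ∈ 𝒢`. -/
structure IsConvexEntropyPair {d : ℕ} (h : ℝ → ℝ) (η : State d → ℝ)
    (q : Fin d → State d → ℝ) : Prop where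
  contDiffOn_entropy : ContDiffOn ℝ 2 η (admissible d h)
  convexOn : ConvexOn ℝ (admissible d h) η
  contDiffOn_flux : ∀ i, ContDiffOn ℝ 1 (q i) (admissible d h)
  compat : ∀ i, ∀ U ∈ admissible d h,
    fderiv ℝ (q i) U = (fderiv ℝ η U).comp (fderiv ℝ (flux h i) U)

/-- Test functions: restrictions to `[0, ∞) × ℝᵈ` of functions in `C_c^∞(ℝ × ℝᵈ)`. -/
def IsTestFunction {d : ℕ} (φ : ℝ × Space d → ℝ) : Prop :=
  ContDiff ℝ ∞ φ ∧ HasCompactSupport φ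

/-- The time derivative `∂_t φ`. -/
noncomputable def dt {d : ℕ} (φ : ℝ × Space d → ℝ) (z : ℝ × Space d) : ℝ :=
  fderiv ℝ φ z ((1 : ℝ), (0 : Space d))

/-- The space derivative `∂φ / ∂x_i`. -/
noncomputable def dx {d : ℕ} (i : Fin d) (φ : ℝ × Space d → ℝ) (z : ℝ × Space d) : ℝ :=
  fderiv ℝ φ z ((0 : ℝ), EuclideanSpace.single i (1 : ℝ))

/-- The closed half space-time `[0, ∞) × ℝᵈ`. -/
def halfSpace (d : ℕ) : Set (ℝ × Space d) := Ici (0 : ℝ) ×ˢ univ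

/-- Weak solutions, with values in `𝒢`, of the Cauchy problem for
`∂_t U + ∑ i, ∂_{x_i} F_i(U) = 0` on `(0, ∞) × ℝᵈ`; the initial datum is `U 0`. -/
structure IsWeakSolution {d : ℕ} (h : ℝ → ℝ) (U : ℝ → Space d → State d) : Prop where
  mem_admissible : ∀ᵐ z ∂(volume.restrict (halfSpace d)), U z.1 z.2 ∈ admissible d h
  mem_admissible_zero : ∀ᵐ x, U 0 x ∈ admissible d h
  locallyIntegrable : LocallyIntegrableOn (fun z : ℝ × Space d => U z.1 z.2) (halfSpace d)
  locallyIntegrable_zero : LocallyIntegrable (U 0)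
  locallyIntegrable_flux : ∀ i,
    LocallyIntegrableOn (fun z : ℝ × Space d => flux h i (U z.1 z.2)) (halfSpace d)
  weak_form : ∀ φ : ℝ × Space d → ℝ, IsTestFunction φ →
    (∫ z in halfSpace d, (dt φ z • U z.1 z.2 + ∑ i, dx i φ z • flux h i (U z.1 z.2)))
      + ∫ x, φ (0, x) • U 0 x = 0

/-- Entropy solutions: weak solutions such that, for every convex entropy pair `(η, q)`,
`∂_t η(U) + ∑ i, ∂_{x_i} q_i(U) ≤ 0` in the sense of distributions, with initial datum `U 0`.
(The functions `η(U)`, `q_i(U)`, `η(U 0)` are locally integrable, so that the inequality has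
a meaning; this is automatic if `U` takes its values, locally, in a compact subset of `𝒢`.) -/
structure IsEntropySolution {d : ℕ} (h : ℝ → ℝ) (U : ℝ → Space d → State d) : Prop
    extends IsWeakSolution h U where
  locallyIntegrable_entropy : ∀ η q, IsConvexEntropyPair h η q →
    LocallyIntegrableOn (fun z : ℝ × Space d => η (U z.1 z.2)) (halfSpace d) ∧
    (∀ i, LocallyIntegrableOn (fun z : ℝ × Space d => q i (U z.1 z.2)) (halfSpace d)) ∧
    LocallyIntegrable (fun x => η (U 0 x))
  entropy_inequality : ∀ η q, IsConvexEntropyPair h η q →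
    ∀ φ : ℝ × Space d → ℝ, IsTestFunction φ → (∀ z, 0 ≤ φ z) →
      0 ≤ (∫ z in halfSpace d, (dt φ z * η (U z.1 z.2) + ∑ i, dx i φ z * q i (U z.1 z.2)))
        + ∫ x, φ (0, x) * η (U 0 x)

/-- The time slice `U(·, t)` is a locally integrable, `𝒢`-valued function, and `s ↦ U(·, s)` is
continuous at `s = t` in the sense of distributions on `ℝᵈ`. (A solution is a class of functions
on space-time modulo null sets; this singles out the representatives for which the slice at this
particular time is meaningful.) -/
structure IsWeaklyContinuousAt {d : ℕ} (h : ℝ → ℝ) (U : ℝ → Space d → State d) (t : ℝ) :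
    Prop where
  mem_admissible : ∀ᵐ x, U t x ∈ admissible d h
  locallyIntegrable : LocallyIntegrable (U t)
  tendsto : ∀ ψ : Space d → ℝ, ContDiff ℝ ∞ ψ → HasCompactSupport ψ →
    Tendsto (fun s => ∫ x, ψ x • U s x) (𝓝 t) (𝓝 (∫ x, ψ x • U t x))

end RelEuler

/-!
The entropies `η = D ((c - S)⁺)³`, with fluxes `η vᵢ`, are convex entropy pairs. They are
nonnegative and vanish exactly where `S ≥ c`. If `c` is a lower bound of the initial entropy, the
initial term of the entropy inequality for `η` is zero. Testing with a function `φ ≥ 0` whose level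
sets are smoothed backward light cones makes `∂ₜφ + v · ∇φ` negative where `φ > 0` and `t > 0`,
because `|v| < 1`. Hence `η (∂ₜφ + v · ∇φ)`, which is nonpositive and has nonnegative integral,
vanishes, and `S ≥ c` almost everywhere on space-time. At a time of weak continuity the bound is
recovered from nearby times, since `S ≥ c` cuts a convex set out of `𝒢`.

Convexity rests on one inequality, `entropy_le_tangent`: the entropy density of a state lies below
the tangent plane of `D S` at any other state. By the logarithm inequality and the bound
`γ γ' (1 - v · v') ≥ (γ / γ' + γ' / γ) / 2` it reduces to the scalar statement
`IsSyngeType.thermal_inequality`, and this is where causality of the equation of state is used.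
A function with supporting hyperplanes of slope `g` is convex, and it is of class `C²` once `g` is
of class `C¹`; so neither Hessians nor second derivatives of the equation of state, which need not
exist, occur.

That the primitive variables are `C¹` functions of the conservative ones, and that `𝒢` is open,
follows from the inverse function theorem in the coordinates `(D, m, θ)`: there the primitive state
is explicit, and only the scalar relation between `θ` and `E` has to be inverted, in which `E` is
strictly increasing by causality. The same monotonicity describes `𝒢` as an increasing union of
convex cones, whence `𝒢` is convex.
-/

open MeasureTheory Set Filter
open scoped Topology ContDiff

namespace RelEuler

/-! ### Equations of state and the tangent inequality -/

namespace IsSyngeType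

variable {h : ℝ → ℝ}

theorem hasDerivAt (hh : IsSyngeType h) {θ : ℝ} (hθ : 0 < θ) : HasDerivAt h (deriv h θ) θ :=
  ((hh.contDiffOn.contDiffAt (Ioi_mem_nhds hθ)).differentiableAt one_ne_zero).hasDerivAt

theorem continuousOn_deriv (hh : IsSyngeType h) : ContinuousOn (deriv h) (Ioi 0) :=
  hh.contDiffOn.continuousOn_deriv_of_isOpen isOpen_Ioi le_rfl

theorem enthalpy_pos (hh : IsSyngeType h) {θ : ℝ} (hθ : 0 < θ) : 0 < h θ :=
  hθ.trans (hh.lt_enthalpy θ hθ)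

/-- The causality condition, cleared of denominators. -/
theorem enthalpy_lt_mul_deriv (hh : IsSyngeType h) {θ : ℝ} (hθ : 0 < θ) :
    h θ < (h θ - θ) * deriv h θ := by
  have h1 := hh.lt_enthalpy θ hθ
  have h2 := hh.causal θ hθ
  rw [div_lt_iff₀ (by linarith)] at h2
  linarith

theorem one_lt_deriv (hh : IsSyngeType h) {θ : ℝ} (hθ : 0 < θ) : 1 < deriv h θ := by
  have h1 := hh.lt_enthalpy θ hθ
  refine lt_trans ?_ (hh.causal θ hθ)
  rw [one_lt_div (by linarith)]
  linarith

theorem strictMonoOn (hh : IsSyngeType h) : StrictMonoOn h (Ioi 0) := by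
  apply strictMonoOn_of_deriv_pos (convex_Ioi 0) hh.contDiffOn.continuousOn
  intro θ hθ
  rw [interior_Ioi] at hθ
  linarith [hh.one_lt_deriv hθ]

/-- The function `h (h - 2θ) = (h - θ)² - θ²` is strictly increasing: this is the causality
condition in integrated form. -/
theorem strictMonoOn_mul_sub (hh : IsSyngeType h) :
    StrictMonoOn (fun θ => h θ * (h θ - 2 * θ)) (Ioi 0) := by
  have hd : ∀ θ : ℝ, 0 < θ → HasDerivAt (fun θ => h θ * (h θ - 2 * θ))
      (deriv h θ * (h θ - 2 * θ) + h θ * (deriv h θ - 2 * 1)) θ := fun θ hθ =>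
    (hh.hasDerivAt hθ).mul ((hh.hasDerivAt hθ).sub ((hasDerivAt_id θ).const_mul 2))
  apply strictMonoOn_of_deriv_pos (convex_Ioi 0)
  · exact fun θ hθ => (hd θ hθ).continuousAt.continuousWithinAt
  · intro θ hθ
    rw [interior_Ioi] at hθ
    rw [(hd θ hθ).deriv]
    nlinarith [hh.enthalpy_lt_mul_deriv hθ]

/-- The pressure is smaller than the total energy density, `θ < h - θ`. -/
theorem two_mul_lt (hh : IsSyngeType h) {θ : ℝ} (hθ : 0 < θ) : 2 * θ < h θ := by
  have key : 0 ≤ h (θ / 2) * (h (θ / 2) - 2 * (θ / 2)) := by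
    -- For small `t` the increasing function `h (h - 2t)` is at least `-t²`.
    have hlim : Tendsto (fun t : ℝ => -t ^ 2) (𝓝[>] 0) (𝓝 0) := by
      have : Tendsto (fun t : ℝ => -t ^ 2) (𝓝 0) (𝓝 (-(0 : ℝ) ^ 2)) :=
        (by fun_prop : Continuous fun t : ℝ => -t ^ 2).tendsto 0
      simp only [ne_eq, OfNat.ofNat_ne_zero, not_false_eq_true, zero_pow, neg_zero] at this
      exact this.mono_left nhdsWithin_le_nhds
    refine le_of_tendsto hlim ?_
    filter_upwards [Ioo_mem_nhdsGT (half_pos hθ)] with t ht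
    have := hh.strictMonoOn_mul_sub (mem_Ioi.2 ht.1) (mem_Ioi.2 (half_pos hθ)) ht.2
    simp only at this
    nlinarith [sq_nonneg (h t - t)]
  have h2 := hh.strictMonoOn_mul_sub (mem_Ioi.2 (half_pos hθ)) (mem_Ioi.2 hθ) (by linarith)
  simp only at h2
  have h3 : 0 < h θ * (h θ - 2 * θ) := lt_of_le_of_lt key h2
  have := (mul_pos_iff_of_pos_left (hh.enthalpy_pos hθ)).1 h3
  linarith

end IsSyngeType

/-- The temperature part `∫_1^θ e'(ξ) / ξ dξ` of the specific entropy. -/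
noncomputable def thermalEntropy (h : ℝ → ℝ) (θ : ℝ) : ℝ :=
  ∫ ξ in (1 : ℝ)..θ, deriv (internalEnergy h) ξ / ξ

namespace IsSyngeType

variable {h : ℝ → ℝ}

theorem deriv_internalEnergy (hh : IsSyngeType h) {θ : ℝ} (hθ : 0 < θ) :
    deriv (internalEnergy h) θ = deriv h θ - 1 :=
  (((hh.hasDerivAt hθ).sub (hasDerivAt_id θ)).sub_const 1).deriv

theorem continuousOn_deriv_internalEnergy_div (hh : IsSyngeType h) :
    ContinuousOn (fun ξ => deriv (internalEnergy h) ξ / ξ) (Ioi 0) := by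
  have : ContinuousOn (fun ξ => (deriv h ξ - 1) / ξ) (Ioi 0) :=
    (hh.continuousOn_deriv.sub continuousOn_const).div continuousOn_id fun x hx => ne_of_gt hx
  exact this.congr fun x hx => by simp only [hh.deriv_internalEnergy hx]

theorem hasDerivAt_thermalEntropy (hh : IsSyngeType h) {θ : ℝ} (hθ : 0 < θ) :
    HasDerivAt (thermalEntropy h) ((deriv h θ - 1) / θ) θ := by
  have hc := hh.continuousOn_deriv_internalEnergy_div
  have hsub : uIcc 1 θ ⊆ Ioi (0 : ℝ) := fun x hx =>
    lt_of_lt_of_le (lt_min one_pos hθ) hx.1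
  have := intervalIntegral.integral_hasDerivAt_right (hc.mono hsub).intervalIntegrable
    (hc.stronglyMeasurableAtFilter isOpen_Ioi θ hθ) (hc.continuousAt (Ioi_mem_nhds hθ))
  rwa [hh.deriv_internalEnergy hθ] at this

theorem contDiffOn_thermalEntropy (hh : IsSyngeType h) :
    ContDiffOn ℝ 1 (thermalEntropy h) (Ioi 0) := by
  rw [show (1 : WithTop ℕ∞) = 0 + 1 from rfl, contDiffOn_succ_iff_deriv_of_isOpen isOpen_Ioi]
  refine ⟨fun θ hθ => (hh.hasDerivAt_thermalEntropy hθ).differentiableAt.differentiableWithinAt,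
    by simp, ?_⟩
  rw [contDiffOn_zero]
  exact hh.continuousOn_deriv_internalEnergy_div.congr fun θ hθ => by
    simp only [(hh.hasDerivAt_thermalEntropy hθ).deriv, hh.deriv_internalEnergy hθ]

/-- For fixed temperature, the expression below is smallest at the positive root `r₀` of
`(h - 2θ) r² + 2 θ₀ r = h`. -/
theorem optimal_ratio_le (H θ θ₀ r r₀ : ℝ) (hθ₀ : 0 < θ₀) (hr : 0 < r) (hr₀ : 0 < r₀)
    (hH : 2 * θ < H) (hroot : (H - 2 * θ) * r₀ ^ 2 + 2 * θ₀ * r₀ = H) :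
    H * (r₀ + r₀⁻¹) / 2 - r₀ * θ + θ₀ * Real.log r₀ ≤
      H * (r + r⁻¹) / 2 - r * θ + θ₀ * Real.log r := by
  have hlog : 1 - r₀ / r ≤ Real.log r - Real.log r₀ := by
    have := Real.log_le_sub_one_of_pos (div_pos hr₀ hr)
    rw [Real.log_div hr₀.ne' hr.ne'] at this
    linarith
  have hlog' := mul_le_mul_of_nonneg_left hlog hθ₀.le
  have key : (H * (r + r⁻¹) / 2 - r * θ) - (H * (r₀ + r₀⁻¹) / 2 - r₀ * θ)
      + θ₀ * (1 - r₀ / r) = (H - 2 * θ) * (r - r₀) ^ 2 / (2 * r) := by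
    have hne := hr.ne'
    have hne₀ := hr₀.ne'
    field_simp
    linear_combination (r - r₀) * hroot
  have : 0 ≤ (H - 2 * θ) * (r - r₀) ^ 2 / (2 * r) :=
    div_nonneg (mul_nonneg (by linarith) (sq_nonneg _)) (by linarith)
  linarith

/-- The scalar core of the concavity of the entropy density `D S`. After minimisation over `r`
the left minus right side is a function of `θ` whose derivative is
`((h - θ)(h' - 1) / θ - 1) (r - 1/r) / 2`; by causality the first factor is positive, and `r - 1`
has the sign of `θ - θ₀`, so that the minimum is attained at `θ = θ₀`. -/
theorem thermal_inequality (hh : IsSyngeType h) {θ θ₀ r : ℝ} (hθ : 0 < θ) (hθ₀ : 0 < θ₀)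
    (hr : 0 < r) :
    h θ₀ - θ₀ - θ₀ * thermalEntropy h θ₀ ≤
      h θ * (r + r⁻¹) / 2 - r * θ + θ₀ * Real.log r - θ₀ * thermalEntropy h θ := by
  set ρ : ℝ → ℝ := fun θ => h θ / (θ₀ + √(θ₀ ^ 2 + h θ * (h θ - 2 * θ))) with hρ
  have hrad : ∀ θ, 0 < θ → 0 < θ₀ ^ 2 + h θ * (h θ - 2 * θ) := fun θ hθ => by
    have := mul_pos (hh.enthalpy_pos hθ) (sub_pos.2 (hh.two_mul_lt hθ))
    positivity
  have hρpos : ∀ θ, 0 < θ → 0 < ρ θ := fun θ hθ =>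
    div_pos (hh.enthalpy_pos hθ) (by positivity)
  have hroot : ∀ θ, 0 < θ → (h θ - 2 * θ) * ρ θ ^ 2 + 2 * θ₀ * ρ θ = h θ := fun θ hθ => by
    have hs := Real.sq_sqrt (hrad θ hθ).le
    have hq : 0 < θ₀ + √(θ₀ ^ 2 + h θ * (h θ - 2 * θ)) := by positivity
    simp only [hρ]
    generalize √(θ₀ ^ 2 + h θ * (h θ - 2 * θ)) = s at hs hq
    have := hq.ne'
    field_simp
    linear_combination (-h θ) * hs
  set g : ℝ → ℝ := fun θ =>
    h θ * (ρ θ + (ρ θ)⁻¹) / 2 - ρ θ * θ + θ₀ * Real.log (ρ θ) - θ₀ * thermalEntropy h θ with hg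
  have hgd : ∀ θ, 0 < θ → HasDerivAt g
      (((h θ - θ) * (deriv h θ - 1) / θ - 1) * ((ρ θ - (ρ θ)⁻¹) / 2)) θ := fun θ hθ => by
    have hd := hh.hasDerivAt hθ
    obtain ⟨ρ', hρ'⟩ : ∃ ρ', HasDerivAt ρ ρ' θ :=
      ⟨_, hd.div ((((hd.mul (hd.sub ((hasDerivAt_id θ).const_mul 2))).const_add _).sqrt
        (hrad θ hθ).ne').const_add _) (by positivity)⟩
    have hne := (hρpos θ hθ).ne'
    have := ((((hd.mul (hρ'.add (hρ'.inv hne))).div_const 2).sub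
      (hρ'.mul (hasDerivAt_id θ))).add ((hρ'.log hne).const_mul θ₀)).sub
      ((hh.hasDerivAt_thermalEntropy hθ).const_mul θ₀)
    refine this.congr_deriv ?_
    have hr0 := hroot θ hθ
    simp only [Pi.add_apply, Pi.inv_apply, id]
    generalize ρ θ = R at hr0 hne
    have hθ' := hθ.ne'
    field_simp
    linear_combination (θ * ρ' - (deriv h θ - 1) * R) * hr0
  have hfac : ∀ θ, 0 < θ → 0 < (h θ - θ) * (deriv h θ - 1) / θ - 1 := fun θ hθ => by
    rw [sub_pos, one_lt_div hθ]
    linarith [hh.enthalpy_lt_mul_deriv hθ]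
  have hgc : ContinuousOn g (Ioi 0) := fun θ hθ => (hgd θ hθ).continuousAt.continuousWithinAt
  have hle : g θ₀ ≤ g θ := by
    rcases le_total θ θ₀ with hc | hc
    · have hanti : AntitoneOn g (Icc θ θ₀) := by
        have hsub : Icc θ θ₀ ⊆ Ioi 0 := fun x hx => lt_of_lt_of_le hθ hx.1
        refine antitoneOn_of_deriv_nonpos (convex_Icc _ _) (hgc.mono hsub)
          (fun x hx => (hgd x (hsub (interior_subset hx))).differentiableAt.differentiableWithinAt)
          fun x hx => ?_
        have hx' := interior_subset hx
        have hx0 : 0 < x := hsub hx'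
        rw [(hgd x hx0).deriv]
        have h1 : ρ x ≤ 1 := by
          refine div_le_one_of_le₀ ?_ (by positivity)
          have : h x - θ₀ ≤ √(θ₀ ^ 2 + h x * (h x - 2 * x)) := by
            apply Real.le_sqrt_of_sq_le
            nlinarith [mul_le_mul_of_nonneg_left hx'.2 (hh.enthalpy_pos hx0).le]
          linarith
        have h2 := one_le_inv_iff₀.2 ⟨hρpos x hx0, h1⟩
        exact mul_nonpos_of_nonneg_of_nonpos (hfac x hx0).le (by linarith)
      exact hanti (left_mem_Icc.2 hc) (right_mem_Icc.2 hc) hc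
    · have hmono : MonotoneOn g (Icc θ₀ θ) := by
        have hsub : Icc θ₀ θ ⊆ Ioi 0 := fun x hx => lt_of_lt_of_le hθ₀ hx.1
        refine monotoneOn_of_deriv_nonneg (convex_Icc _ _) (hgc.mono hsub)
          (fun x hx => (hgd x (hsub (interior_subset hx))).differentiableAt.differentiableWithinAt)
          fun x hx => ?_
        have hx' := interior_subset hx
        have hx0 : 0 < x := hsub hx'
        rw [(hgd x hx0).deriv]
        have h1 : 1 ≤ ρ x := by
          simp only [hρ]
          rw [one_le_div (by positivity)]
          have : √(θ₀ ^ 2 + h x * (h x - 2 * x)) ≤ h x - θ₀ := by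
            apply Real.sqrt_le_iff.2 ⟨by linarith [hx'.1, hh.two_mul_lt hx0], ?_⟩
            nlinarith [mul_le_mul_of_nonneg_left hx'.1 (hh.enthalpy_pos hx0).le]
          linarith
        have h2 := inv_le_one_of_one_le₀ h1
        exact mul_nonneg (hfac x hx0).le (by linarith)
      exact hmono (left_mem_Icc.2 hc) (right_mem_Icc.2 hc) hc
  have hρ₀ : ρ θ₀ = 1 := by
    have hlt := hh.two_mul_lt hθ₀
    have : √(θ₀ ^ 2 + h θ₀ * (h θ₀ - 2 * θ₀)) = h θ₀ - θ₀ := by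
      rw [show θ₀ ^ 2 + h θ₀ * (h θ₀ - 2 * θ₀) = (h θ₀ - θ₀) ^ 2 by ring]
      exact Real.sqrt_sq (by linarith)
    simp only [hρ, this]
    rw [add_sub_cancel, div_self (hh.enthalpy_pos hθ₀).ne']
  have hg₀ : g θ₀ = h θ₀ - θ₀ - θ₀ * thermalEntropy h θ₀ := by
    simp only [hg, hρ₀, inv_one, Real.log_one]
    ring
  have hopt := optimal_ratio_le (h θ) θ θ₀ r (ρ θ) hθ₀ hr (hρpos θ hθ) (hh.two_mul_lt hθ)
    (hroot θ hθ)
  rw [← hg₀]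
  simp only [hg] at hle ⊢
  linarith

end IsSyngeType

theorem lorentz_pos {d : ℕ} {v : Space d} (hv : ‖v‖ < 1) : 0 < lorentz v := by
  have := norm_nonneg v
  exact inv_pos.2 (Real.sqrt_pos.2 (by nlinarith))

theorem lorentz_sq_mul {d : ℕ} {v : Space d} (hv : ‖v‖ < 1) :
    lorentz v ^ 2 * (1 - ‖v‖ ^ 2) = 1 := by
  have := norm_nonneg v
  have h1 : 0 < 1 - ‖v‖ ^ 2 := by nlinarith
  rw [lorentz, inv_pow, Real.sq_sqrt h1.le, inv_mul_cancel₀ h1.ne']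

/-- The relative Lorentz factor `γ γ' (1 - v · v')` of two velocities dominates the mean of
`γ / γ'` and `γ' / γ`. -/
theorem lorentz_mul_lorentz_ge {d : ℕ} {v w : Space d} (hv : ‖v‖ < 1) (hw : ‖w‖ < 1) :
    (lorentz w / lorentz v + (lorentz w / lorentz v)⁻¹) / 2 ≤
      lorentz v * lorentz w * (1 - inner ℝ w v) := by
  have hv0 := lorentz_pos hv
  have hw0 := lorentz_pos hw
  have hv2 := lorentz_sq_mul hv
  have hw2 := lorentz_sq_mul hw
  have hn : ‖w - v‖ ^ 2 = ‖w‖ ^ 2 - 2 * inner ℝ w v + ‖v‖ ^ 2 := norm_sub_sq_real w v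
  have hpos : 0 ≤ lorentz v * lorentz w * ‖w - v‖ ^ 2 := by positivity
  have : lorentz v * lorentz w * (1 - inner ℝ w v) =
      (lorentz w / lorentz v + (lorentz w / lorentz v)⁻¹) / 2
        + lorentz v * lorentz w * ‖w - v‖ ^ 2 / 2 := by
    rw [hn]
    generalize lorentz v = a at *
    generalize lorentz w = b at *
    field_simp
    linear_combination (b ^ 2) * hv2 + a ^ 2 * hw2
  linarith

/-- The specific entropy as a function of the primitive state. -/
noncomputable def primEntropy {d : ℕ} (h : ℝ → ℝ) (V : State d) : ℝ :=
  -Real.log V.1 + thermalEntropy h (V.2.2 / V.1)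

/-- The covector `(S - h / θ, -γ v / θ, γ / θ)` at a primitive state: the differential of the
entropy density `D S` with respect to the conservative variables. -/
noncomputable def entropyGradient {d : ℕ} (h : ℝ → ℝ) (V : State d) : State d →L[ℝ] ℝ :=
  (primEntropy h V - h (V.2.2 / V.1) / (V.2.2 / V.1)) • ContinuousLinearMap.fst ℝ ℝ (Space d × ℝ)
    + (lorentz V.2.1 / (V.2.2 / V.1)) •
      (ContinuousLinearMap.snd ℝ (Space d) ℝ - (innerSL ℝ V.2.1).comp
        (ContinuousLinearMap.fst ℝ (Space d) ℝ)).comp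
        (ContinuousLinearMap.snd ℝ ℝ (Space d × ℝ))

theorem entropyGradient_apply {d : ℕ} (h : ℝ → ℝ) (V a : State d) :
    entropyGradient h V a = (primEntropy h V - h (V.2.2 / V.1) / (V.2.2 / V.1)) * a.1
      + lorentz V.2.1 / (V.2.2 / V.1) * (a.2.2 - inner ℝ V.2.1 a.2.1) := by
  simp [entropyGradient]

theorem entropyGradient_self {d : ℕ} {h : ℝ → ℝ} {V : State d}
    (hV : V ∈ primAdmissible d) :
    (primToCons h V).1 + entropyGradient h V (primToCons h V) =
      (primToCons h V).1 * primEntropy h V := by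
  obtain ⟨ρ, v, p⟩ := V
  obtain ⟨hρ, hv, hp⟩ := hV
  simp only at hρ hv hp
  have h0 := (lorentz_pos hv).ne'
  have h2 := lorentz_sq_mul hv
  simp only [entropyGradient_apply, primToCons, inner_smul_right, real_inner_self_eq_norm_sq]
  generalize primEntropy h (ρ, v, p) = S
  generalize lorentz v = γ at *
  generalize h (p / ρ) = H
  field_simp
  linear_combination ρ * H * h2

/-- Every admissible state lies below the tangent planes of the entropy density `D S`. -/
theorem entropy_le_tangent {d : ℕ} {h : ℝ → ℝ} (hh : IsSyngeType h) {V W : State d}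
    (hV : V ∈ primAdmissible d) (hW : W ∈ primAdmissible d) :
    (primToCons h V).1 * primEntropy h V ≤
      (primToCons h W).1 + entropyGradient h W (primToCons h V) := by
  obtain ⟨ρ, v, p⟩ := V
  obtain ⟨ρ₀, w, p₀⟩ := W
  obtain ⟨hρ, hv, hp⟩ := hV
  obtain ⟨hρ₀, hw, hp₀⟩ := hW
  simp only at hρ hv hp hρ₀ hw hp₀
  have hv0 := lorentz_pos hv
  have hw0 := lorentz_pos hw
  have hlor := lorentz_mul_lorentz_ge hv hw
  obtain ⟨θ, rfl⟩ : ∃ θ, p = θ * ρ := ⟨p / ρ, by field_simp⟩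
  obtain ⟨θ₀, rfl⟩ : ∃ θ, p₀ = θ * ρ₀ := ⟨p₀ / ρ₀, by field_simp⟩
  have hθ : 0 < θ := pos_of_mul_pos_left hp hρ.le
  have hθ₀ : 0 < θ₀ := pos_of_mul_pos_left hp₀ hρ₀.le
  have hr : 0 < lorentz w / lorentz v := div_pos hw0 hv0
  have hth := hh.thermal_inequality hθ hθ₀ hr
  simp only [entropyGradient_apply, primToCons, inner_smul_right, primEntropy]
  rw [mul_div_cancel_right₀ _ hρ.ne', mul_div_cancel_right₀ _ hρ₀.ne']
  have hlog : Real.log (lorentz w / lorentz v) + Real.log ρ₀ - Real.log ρ ≤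
      lorentz w / lorentz v * (ρ₀ / ρ) - 1 := by
    have := Real.log_le_sub_one_of_pos (mul_pos hr (div_pos hρ₀ hρ))
    rw [Real.log_mul hr.ne' (div_pos hρ₀ hρ).ne', Real.log_div hρ₀.ne' hρ.ne'] at this
    linarith
  have hH := hh.enthalpy_pos hθ
  have hlor' := mul_le_mul_of_nonneg_left hlor hH.le
  have hlog' := mul_le_mul_of_nonneg_left hlog hθ₀.le
  have hsum : θ₀ * (-Real.log ρ + thermalEntropy h θ) ≤
      θ₀ * (lorentz w / lorentz v * (ρ₀ / ρ)) + θ₀ * (-Real.log ρ₀ + thermalEntropy h θ₀) - h θ₀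
        + h θ * (lorentz v * lorentz w * (1 - inner ℝ w v)) - lorentz w / lorentz v * θ := by
    linarith
  have hmul := mul_le_mul_of_nonneg_left hsum (by positivity : 0 ≤ ρ * lorentz v / θ₀)
  refine (le_of_eq ?_).trans (hmul.trans (le_of_eq ?_))
  · field_simp
  · have := hv0.ne'
    field_simp
    ring

/-! ### The coordinates `(D, m, θ)` and the geometry of the admissible set -/

variable {d : ℕ} {h : ℝ → ℝ}

/-- The domain `D > 0`, `θ > 0` of the coordinates `(D, m, θ)`. -/
def chartDomain (d : ℕ) : Set (State d) := {W | 0 < W.1 ∧ 0 < W.2.2}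

/-- The quantity `ρ h γ² = E + p = √((h D)² + |m|²)` in the coordinates `(D, m, θ)`. -/
noncomputable def chartRadius (h : ℝ → ℝ) (W : State d) : ℝ :=
  √((h W.2.2 * W.1) ^ 2 + ‖W.2.1‖ ^ 2)

/-- The energy `E` in the coordinates `(D, m, θ)`. -/
noncomputable def chartEnergy (h : ℝ → ℝ) (W : State d) : ℝ :=
  chartRadius h W - W.2.2 * (h W.2.2 * W.1 ^ 2 / chartRadius h W)

/-- The conservative state with coordinates `(D, m, θ)`. In these coordinates the primitive
variables are explicit, and only the last component has to be inverted. -/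
noncomputable def chart (h : ℝ → ℝ) (W : State d) : State d := (W.1, W.2.1, chartEnergy h W)

/-- The primitive state with coordinates `(D, m, θ)`. -/
noncomputable def chartPrim (h : ℝ → ℝ) (W : State d) : State d :=
  (h W.2.2 * W.1 ^ 2 / chartRadius h W, (chartRadius h W)⁻¹ • W.2.1,
    W.2.2 * (h W.2.2 * W.1 ^ 2 / chartRadius h W))

theorem isOpen_chartDomain : IsOpen (chartDomain d) :=
  (isOpen_lt continuous_const continuous_fst).inter
    (isOpen_lt continuous_const (continuous_snd.comp continuous_snd))

theorem IsSyngeType.chartRadicand_pos (hh : IsSyngeType h) {W : State d}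
    (hW : W ∈ chartDomain d) : 0 < (h W.2.2 * W.1) ^ 2 + ‖W.2.1‖ ^ 2 := by
  have := mul_pos (hh.enthalpy_pos hW.2) hW.1
  positivity

theorem IsSyngeType.chartRadius_pos (hh : IsSyngeType h) {W : State d}
    (hW : W ∈ chartDomain d) : 0 < chartRadius h W :=
  Real.sqrt_pos.2 (hh.chartRadicand_pos hW)

theorem chartRadius_sq (h : ℝ → ℝ) (W : State d) :
    chartRadius h W ^ 2 = (h W.2.2 * W.1) ^ 2 + ‖W.2.1‖ ^ 2 :=
  Real.sq_sqrt (by positivity)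

theorem IsSyngeType.chartPrim_mem (hh : IsSyngeType h) {W : State d}
    (hW : W ∈ chartDomain d) : chartPrim h W ∈ primAdmissible d := by
  have hA := hh.chartRadius_pos hW
  have hH := hh.enthalpy_pos hW.2
  have hD := hW.1
  have hρ : 0 < h W.2.2 * W.1 ^ 2 / chartRadius h W := by positivity
  refine ⟨hρ, ?_, mul_pos hW.2 hρ⟩
  simp only [chartPrim]
  rw [norm_smul, Real.norm_of_nonneg (inv_pos.2 hA).le, inv_mul_lt_one₀ hA]
  have := chartRadius_sq h W
  have h2 := mul_pos hH hD
  nlinarith [norm_nonneg W.2.1]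

theorem lorentz_eq_of_sq_mul {v : Space d} (hv : ‖v‖ < 1) {γ : ℝ} (hγ : 0 ≤ γ)
    (h2 : γ ^ 2 * (1 - ‖v‖ ^ 2) = 1) : lorentz v = γ := by
  have h1 := lorentz_sq_mul hv
  have h3 : 1 - ‖v‖ ^ 2 ≠ 0 := fun h0 => by simp [h0] at h2
  exact (pow_left_inj₀ (lorentz_pos hv).le hγ two_ne_zero).1
    (mul_right_cancel₀ h3 (h1.trans h2.symm))

theorem IsSyngeType.lorentz_chartPrim (hh : IsSyngeType h) {W : State d}
    (hW : W ∈ chartDomain d) :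
    lorentz (chartPrim h W).2.1 = chartRadius h W / (h W.2.2 * W.1) := by
  have hA := hh.chartRadius_pos hW
  have hH := hh.enthalpy_pos hW.2
  have hD := hW.1
  apply lorentz_eq_of_sq_mul (hh.chartPrim_mem hW).2.1 (by positivity)
  have h2 := chartRadius_sq h W
  simp only [chartPrim]
  rw [norm_smul, Real.norm_of_nonneg (inv_pos.2 hA).le]
  field_simp
  linear_combination h2

theorem IsSyngeType.primToCons_chartPrim (hh : IsSyngeType h) {W : State d}
    (hW : W ∈ chartDomain d) : primToCons h (chartPrim h W) = chart h W := by
  have hA := hh.chartRadius_pos hW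
  have hH := hh.enthalpy_pos hW.2
  have hD := hW.1
  rw [primToCons, hh.lorentz_chartPrim hW]
  have hρ : h W.2.2 * W.1 ^ 2 / chartRadius h W ≠ 0 := by positivity
  simp only [chartPrim, chart, chartEnergy, mul_div_cancel_right₀ _ hρ]
  refine Prod.ext ?_ (Prod.ext ?_ ?_)
  · simp only
    field_simp
  · simp only [smul_smul]
    convert one_smul ℝ W.2.1
    field_simp
  · simp only
    congr 1
    field_simp

theorem IsSyngeType.exists_chartPrim_eq (hh : IsSyngeType h) {V : State d}
    (hV : V ∈ primAdmissible d) : ∃ W ∈ chartDomain d, chartPrim h W = V := by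
  obtain ⟨ρ, v, p⟩ := V
  obtain ⟨hρ, hv, hp⟩ := hV
  simp only at hρ hv hp
  have hγ := lorentz_pos hv
  have h2 := lorentz_sq_mul hv
  have hH := hh.enthalpy_pos (div_pos hp hρ)
  have hA : chartRadius h ((ρ * lorentz v, (ρ * h (p / ρ) * lorentz v ^ 2) • v, p / ρ) : State d)
      = ρ * h (p / ρ) * lorentz v ^ 2 := by
    rw [chartRadius]
    simp only [norm_smul, Real.norm_eq_abs, mul_pow, sq_abs]
    refine (Real.sqrt_eq_iff_mul_self_eq_of_pos (by positivity)).2 ?_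
    linear_combination (ρ * h (p / ρ) * lorentz v) ^ 2 * h2
  refine ⟨(ρ * lorentz v, (ρ * h (p / ρ) * lorentz v ^ 2) • v, p / ρ),
    ⟨mul_pos hρ hγ, div_pos hp hρ⟩, ?_⟩
  rw [chartPrim, hA]
  simp only
  generalize h (p / ρ) = H at *
  have e1 : H * (ρ * lorentz v) ^ 2 / (ρ * H * lorentz v ^ 2) = ρ := by field_simp
  rw [e1, smul_smul, inv_mul_cancel₀ (by positivity), one_smul, div_mul_cancel₀ _ hρ.ne']

theorem IsSyngeType.admissible_eq_image (hh : IsSyngeType h) :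
    admissible d h = chart h '' chartDomain d := by
  ext U
  constructor
  · rintro ⟨V, hV, rfl⟩
    obtain ⟨W, hW, rfl⟩ := hh.exists_chartPrim_eq hV
    exact ⟨W, hW, (hh.primToCons_chartPrim hW).symm⟩
  · rintro ⟨W, hW, rfl⟩
    exact ⟨chartPrim h W, hh.chartPrim_mem hW, hh.primToCons_chartPrim hW⟩

/-- The energy increases with the temperature at fixed `D` and `m`; this is where causality
enters. -/
theorem IsSyngeType.exists_hasDerivAt_chartEnergy (hh : IsSyngeType h) {D : ℝ} (hD : 0 < D)
    (m : Space d) {θ : ℝ} (hθ : 0 < θ) :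
    ∃ κ, 0 < κ ∧ HasDerivAt (fun θ => chartEnergy h (D, m, θ)) κ θ := by
  have hW : ((D, m, θ) : State d) ∈ chartDomain d := ⟨hD, hθ⟩
  have hA := hh.chartRadius_pos hW
  have hAsq := chartRadius_sq h ((D, m, θ) : State d)
  have hd := hh.hasDerivAt hθ
  have hH := hh.enthalpy_pos hθ
  have hAd : HasDerivAt (fun θ => chartRadius h ((D, m, θ) : State d))
      (h θ * deriv h θ * D ^ 2 / chartRadius h ((D, m, θ) : State d)) θ := by
    have := (((hd.mul_const D).pow 2).add_const (‖m‖ ^ 2)).sqrt (hh.chartRadicand_pos hW).ne'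
    refine this.congr_deriv ?_
    simp only [chartRadius, Pi.pow_apply]
    have hpos : 0 < √((h θ * D) ^ 2 + ‖m‖ ^ 2) := hA
    push_cast
    field_simp
  refine ⟨_, ?_, hAd.sub ((hasDerivAt_id θ).mul ((hd.mul_const (D ^ 2)).div hAd hA.ne'))⟩
  simp only [id]
  generalize chartRadius h ((D, m, θ) : State d) = A at *
  have key := hh.enthalpy_lt_mul_deriv hθ
  have hd1 := hh.one_lt_deriv hθ
  have : h θ * deriv h θ * D ^ 2 / A - (1 * (h θ * D ^ 2 / A) +
      θ * ((deriv h θ * D ^ 2 * A - h θ * D ^ 2 * (h θ * deriv h θ * D ^ 2 / A)) / A ^ 2))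
      = D ^ 2 / A * (((h θ - θ) * deriv h θ - h θ) + θ * h θ ^ 2 * deriv h θ * D ^ 2 / A ^ 2) := by
    field_simp
    ring
  rw [this]
  have h1 : 0 < (h θ - θ) * deriv h θ - h θ := by linarith
  have h2 : 0 < deriv h θ := by linarith
  positivity

theorem IsSyngeType.strictMonoOn_chartEnergy (hh : IsSyngeType h) {D : ℝ} (hD : 0 < D)
    (m : Space d) : StrictMonoOn (fun θ => chartEnergy h (D, m, θ)) (Ioi 0) := by
  apply strictMonoOn_of_deriv_pos (convex_Ioi 0)
  · intro θ hθ
    obtain ⟨κ, -, hκ⟩ := hh.exists_hasDerivAt_chartEnergy hD m hθ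
    exact hκ.continuousAt.continuousWithinAt
  · intro θ hθ
    rw [interior_Ioi] at hθ
    obtain ⟨κ, hκ0, hκ⟩ := hh.exists_hasDerivAt_chartEnergy hD m hθ
    rwa [hκ.deriv]

theorem IsSyngeType.injOn_chart (hh : IsSyngeType h) : InjOn (chart h) (chartDomain d) := by
  rintro ⟨D, m, θ⟩ ⟨hD, hθ⟩ ⟨D', m', θ'⟩ ⟨hD', hθ'⟩ heq
  simp only [chart, Prod.mk.injEq] at heq
  obtain ⟨rfl, rfl, h3⟩ := heq
  have := (hh.strictMonoOn_chartEnergy hD m).injOn hθ hθ' h3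
  simp_all

theorem IsSyngeType.injOn_primToCons (hh : IsSyngeType h) :
    InjOn (primToCons h) (primAdmissible d) := by
  intro V hV V' hV' heq
  obtain ⟨W, hW, rfl⟩ := hh.exists_chartPrim_eq hV
  obtain ⟨W', hW', rfl⟩ := hh.exists_chartPrim_eq hV'
  rw [hh.primToCons_chartPrim hW, hh.primToCons_chartPrim hW'] at heq
  rw [hh.injOn_chart hW hW' heq]

theorem IsSyngeType.consToPrim_primToCons (hh : IsSyngeType h) {V : State d}
    (hV : V ∈ primAdmissible d) : consToPrim h (primToCons h V) = V :=
  hh.injOn_primToCons (consToPrim_mem ⟨V, hV, rfl⟩) hV (primToCons_consToPrim ⟨V, hV, rfl⟩)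

theorem IsSyngeType.consToPrim_chart (hh : IsSyngeType h) {W : State d}
    (hW : W ∈ chartDomain d) : consToPrim h (chart h W) = chartPrim h W := by
  rw [← hh.primToCons_chartPrim hW, hh.consToPrim_primToCons (hh.chartPrim_mem hW)]

section Smoothness

theorem IsSyngeType.contDiffAt_enthalpy (hh : IsSyngeType h) {θ : ℝ} (hθ : 0 < θ) :
    ContDiffAt ℝ 1 h θ :=
  hh.contDiffOn.contDiffAt (Ioi_mem_nhds hθ)

theorem IsSyngeType.contDiffAt_enthalpy_chart (hh : IsSyngeType h) {W : State d}
    (hW : W ∈ chartDomain d) : ContDiffAt ℝ 1 (fun W : State d => h W.2.2) W :=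
  (hh.contDiffAt_enthalpy hW.2).comp W (contDiff_snd.snd).contDiffAt

theorem IsSyngeType.contDiffAt_chartRadius (hh : IsSyngeType h) {W : State d}
    (hW : W ∈ chartDomain d) : ContDiffAt ℝ 1 (chartRadius h) W :=
  ((((hh.contDiffAt_enthalpy_chart hW).mul contDiff_fst.contDiffAt).pow 2).add
    (contDiff_snd.fst.norm_sq ℝ).contDiffAt).sqrt (hh.chartRadicand_pos hW).ne'

theorem IsSyngeType.contDiffAt_chartDensity (hh : IsSyngeType h) {W : State d}
    (hW : W ∈ chartDomain d) :
    ContDiffAt ℝ 1 (fun W : State d => h W.2.2 * W.1 ^ 2 / chartRadius h W) W :=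
  ((hh.contDiffAt_enthalpy_chart hW).mul (contDiff_fst.pow 2).contDiffAt).div
    (hh.contDiffAt_chartRadius hW) (hh.chartRadius_pos hW).ne'

theorem IsSyngeType.contDiffAt_chartEnergy (hh : IsSyngeType h) {W : State d}
    (hW : W ∈ chartDomain d) : ContDiffAt ℝ 1 (chartEnergy h) W :=
  (hh.contDiffAt_chartRadius hW).sub
    (contDiff_snd.snd.contDiffAt.mul (hh.contDiffAt_chartDensity hW))

theorem IsSyngeType.contDiffAt_chart (hh : IsSyngeType h) {W : State d}
    (hW : W ∈ chartDomain d) : ContDiffAt ℝ 1 (chart h) W :=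
  contDiff_fst.contDiffAt.prodMk (contDiff_snd.fst.contDiffAt.prodMk
    (hh.contDiffAt_chartEnergy hW))

theorem IsSyngeType.contDiffAt_chartPrim (hh : IsSyngeType h) {W : State d}
    (hW : W ∈ chartDomain d) : ContDiffAt ℝ 1 (chartPrim h) W :=
  (hh.contDiffAt_chartDensity hW).prodMk
    ((((hh.contDiffAt_chartRadius hW).inv (hh.chartRadius_pos hW).ne').smul
      contDiff_snd.fst.contDiffAt).prodMk
      (contDiff_snd.snd.contDiffAt.mul (hh.contDiffAt_chartDensity hW)))

theorem IsSyngeType.exists_hasFDerivAt_chart (hh : IsSyngeType h) {W : State d}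
    (hW : W ∈ chartDomain d) :
    ∃ L : State d ≃L[ℝ] State d, HasFDerivAt (chart h) (L : State d →L[ℝ] State d) W := by
  have hE := ((hh.contDiffAt_chartEnergy hW).differentiableAt one_ne_zero).hasFDerivAt
  set ℓ := fderiv ℝ (chartEnergy h) W with hℓ
  obtain ⟨κ, hκ0, hκ⟩ := hh.exists_hasDerivAt_chartEnergy hW.1 W.2.1 hW.2
  have hcol : ℓ ((0 : ℝ), (0 : Space d), (1 : ℝ)) = κ := by
    have hc : HasDerivAt (fun θ : ℝ => ((W.1, W.2.1, θ) : State d))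
        ((0 : ℝ), (0 : Space d), (1 : ℝ)) W.2.2 :=
      (hasDerivAt_const _ _).prodMk ((hasDerivAt_const _ _).prodMk (hasDerivAt_id _))
    exact (HasFDerivAt.comp_hasDerivAt (x := W.2.2)
      (f := fun θ : ℝ => ((W.1, W.2.1, θ) : State d)) hE hc).unique hκ
  have hT : HasFDerivAt (chart h) ((ContinuousLinearMap.fst ℝ ℝ (Space d × ℝ)).prod
      (((ContinuousLinearMap.fst ℝ (Space d) ℝ).comp
        (ContinuousLinearMap.snd ℝ ℝ (Space d × ℝ))).prod ℓ)) W :=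
    hasFDerivAt_fst.prodMk ((hasFDerivAt_snd.fst).prodMk hE)
  set T := (ContinuousLinearMap.fst ℝ ℝ (Space d × ℝ)).prod
      (((ContinuousLinearMap.fst ℝ (Space d) ℝ).comp
        (ContinuousLinearMap.snd ℝ ℝ (Space d × ℝ))).prod ℓ) with hTdef
  have hinj : Function.Injective (T : State d →ₗ[ℝ] State d) := by
    rw [← LinearMap.ker_eq_bot, LinearMap.ker_eq_bot']
    rintro ⟨a, b, c⟩ habc
    have h0 : T (a, b, c) = 0 := habc
    simp only [hTdef, ContinuousLinearMap.prod_apply, ContinuousLinearMap.coe_fst',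
      ContinuousLinearMap.coe_comp, Function.comp_apply, ContinuousLinearMap.coe_snd',
      Prod.mk_eq_zero] at h0
    obtain ⟨rfl, rfl, hc⟩ := h0
    have : ((0 : ℝ), (0 : Space d), c) = c • ((0 : ℝ), (0 : Space d), (1 : ℝ)) := by simp
    rw [this, map_smul, hcol, smul_eq_mul, mul_eq_zero] at hc
    rcases hc with rfl | hc
    · rfl
    · exact absurd hc hκ0.ne'
  refine ⟨(LinearEquiv.ofInjectiveEndo _ hinj).toContinuousLinearEquiv, ?_⟩
  convert! hT

theorem IsSyngeType.admissible_mem_nhds (hh : IsSyngeType h) {U : State d}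
    (hU : U ∈ admissible d h) : admissible d h ∈ 𝓝 U := by
  rw [hh.admissible_eq_image] at hU ⊢
  obtain ⟨W, hW, rfl⟩ := hU
  obtain ⟨L, hL⟩ := hh.exists_hasFDerivAt_chart hW
  rw [← ((hh.contDiffAt_chart hW).hasStrictFDerivAt' hL one_ne_zero).map_nhds_eq_of_equiv]
  exact image_mem_map (isOpen_chartDomain.mem_nhds hW)

theorem IsSyngeType.isOpen_admissible (hh : IsSyngeType h) : IsOpen (admissible d h) :=
  isOpen_iff_mem_nhds.2 fun _ hU => hh.admissible_mem_nhds hU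

theorem IsSyngeType.contDiffAt_consToPrim (hh : IsSyngeType h) {U : State d}
    (hU : U ∈ admissible d h) : ContDiffAt ℝ 1 (consToPrim h) U := by
  rw [hh.admissible_eq_image] at hU
  obtain ⟨W, hW, rfl⟩ := hU
  obtain ⟨L, hL⟩ := hh.exists_hasFDerivAt_chart hW
  have hc := hh.contDiffAt_chart hW
  have hs := hc.hasStrictFDerivAt' hL one_ne_zero
  have hinv := hc.to_localInverse hL one_ne_zero
  have hat := hc.localInverse_apply_image hL one_ne_zero
  have hcomp : ContDiffAt ℝ 1 (chartPrim h ∘ hc.localInverse hL one_ne_zero) (chart h W) :=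
    ContDiffAt.comp _ (by rw [hat]; exact hh.contDiffAt_chartPrim hW) hinv
  refine hcomp.congr_of_eventuallyEq ?_
  have hmem : ∀ᶠ U in 𝓝 (chart h W), hc.localInverse hL one_ne_zero U ∈ chartDomain d := by
    apply hinv.continuousAt.eventually_mem
    rw [hat]
    exact isOpen_chartDomain.mem_nhds hW
  filter_upwards [hmem, hs.eventually_right_inverse] with U hU1 hU2
  rw [Function.comp_apply, ← hh.consToPrim_chart hU1]
  exact congrArg _ hU2.symm

end Smoothness

section Convexity

/-- A description of the admissible set free of the temperature: `E ≥ √((h₀ D)² + |m|²)` for some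
value `h₀ = h t` of the enthalpy. For fixed `t` the condition describes a convex cone, and the
cones decrease in `t`. -/
theorem IsSyngeType.mem_admissible_iff (hh : IsSyngeType h) {U : State d} :
    U ∈ admissible d h ↔
      0 < U.1 ∧ ∃ t, 0 < t ∧ √((h t * U.1) ^ 2 + ‖U.2.1‖ ^ 2) ≤ U.2.2 := by
  obtain ⟨D, m, E⟩ := U
  rw [hh.admissible_eq_image]
  -- The correction `E - √((h D)² + |m|²) = -p` lies between `-t D` and `0`.
  have hcorr : ∀ t, 0 < t → 0 < D → 0 ≤ t * (h t * D ^ 2 / chartRadius h (D, m, t)) ∧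
      t * (h t * D ^ 2 / chartRadius h (D, m, t)) ≤ t * D := by
    intro t ht hD
    have hA := hh.chartRadius_pos (W := (D, m, t)) ⟨hD, ht⟩
    have hH := hh.enthalpy_pos ht
    refine ⟨by positivity, mul_le_mul_of_nonneg_left ?_ ht.le⟩
    rw [div_le_iff₀ hA]
    have : h t * D ≤ chartRadius h (D, m, t) := by
      apply Real.le_sqrt_of_sq_le
      have := sq_nonneg ‖m‖
      simp only
      linarith
    nlinarith
  constructor
  · rintro ⟨⟨D', m', θ⟩, ⟨hD, hθ⟩, heq⟩
    simp only [chart, Prod.mk.injEq] at heq hD hθ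
    obtain ⟨rfl, rfl, rfl⟩ := heq
    refine ⟨hD, ?_⟩
    have hlt := hh.strictMonoOn_chartEnergy hD m' (mem_Ioi.2 (half_pos hθ)) hθ (half_lt_self hθ)
    simp only at hlt
    set δ := chartEnergy h (D', m', θ) - chartEnergy h (D', m', θ / 2) with hδ
    have hδ0 : 0 < δ := sub_pos.2 hlt
    have htpos : 0 < min (θ / 2) (δ / D') := lt_min (half_pos hθ) (div_pos hδ0 hD)
    refine ⟨_, htpos, ?_⟩
    set t := min (θ / 2) (δ / D')
    have h1 : chartEnergy h (D', m', t) ≤ chartEnergy h (D', m', θ / 2) :=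
      (hh.strictMonoOn_chartEnergy hD m').monotoneOn htpos (half_pos hθ) (min_le_left _ _)
    have h2 := (hcorr t htpos hD).2
    have h3 : t * D' ≤ δ := (le_div_iff₀ hD).1 (min_le_right _ _)
    have h4 : chartEnergy h (D', m', t) = √((h t * D') ^ 2 + ‖m'‖ ^ 2) -
      t * (h t * D' ^ 2 / chartRadius h (D', m', t)) := rfl
    simp only
    linarith
  · rintro ⟨hD, t, ht, hle⟩
    simp only at hD hle
    have hlow : chartEnergy h (D, m, t) ≤ E := by
      have := (hcorr t ht hD).1
      have h4 : chartEnergy h (D, m, t) = √((h t * D) ^ 2 + ‖m‖ ^ 2) -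
        t * (h t * D ^ 2 / chartRadius h (D, m, t)) := rfl
      linarith
    have hs : 0 < max t (E / D) := lt_max_of_lt_left ht
    have hhigh : E ≤ chartEnergy h (D, m, max t (E / D)) := by
      have h1 := (hcorr _ hs hD).2
      have h4 : chartEnergy h (D, m, max t (E / D)) =
        √((h (max t (E / D)) * D) ^ 2 + ‖m‖ ^ 2) - max t (E / D) *
          (h (max t (E / D)) * D ^ 2 / chartRadius h (D, m, max t (E / D))) := rfl
      have h5 : h (max t (E / D)) * D ≤ √((h (max t (E / D)) * D) ^ 2 + ‖m‖ ^ 2) := by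
        apply Real.le_sqrt_of_sq_le
        have := sq_nonneg ‖m‖
        linarith
      have h6 := mul_lt_mul_of_pos_right (hh.two_mul_lt hs) hD
      have h7 : E ≤ max t (E / D) * D := (div_le_iff₀ hD).1 (le_max_right _ _)
      linarith
    have hcont : ContinuousOn (fun θ => chartEnergy h (D, m, θ)) (Icc t (max t (E / D))) := by
      intro θ hθ
      obtain ⟨κ, -, hκ⟩ := hh.exists_hasDerivAt_chartEnergy hD m (ht.trans_le hθ.1)
      exact hκ.continuousAt.continuousWithinAt
    obtain ⟨θ, hθ, hEθ⟩ := intermediate_value_Icc (le_max_left _ _) hcont ⟨hlow, hhigh⟩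
    refine ⟨(D, m, θ), ⟨hD, ht.trans_le hθ.1⟩, ?_⟩
    simp only at hEθ
    simp only [chart, hEθ]

theorem sqrt_sq_add_norm_sq_eq_norm (c : ℝ) (m : Space d) :
    √(c ^ 2 + ‖m‖ ^ 2) = ‖WithLp.toLp 2 (c, m)‖ := by
  rw [WithLp.prod_norm_eq_of_L2]
  simp

theorem IsSyngeType.convex_admissible (hh : IsSyngeType h) : Convex ℝ (admissible d h) := by
  rw [convex_iff_forall_pos]
  rintro ⟨D, m, E⟩ hU ⟨D', m', E'⟩ hU' a b ha hb -
  rw [hh.mem_admissible_iff] at hU hU' ⊢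
  obtain ⟨hD, t, ht, hle⟩ := hU
  obtain ⟨hD', t', ht', hle'⟩ := hU'
  simp only [Prod.smul_mk, Prod.mk_add_mk, smul_eq_mul] at hD hle hD' hle' ⊢
  have hmin : 0 < min t t' := lt_min ht ht'
  have hH := hh.enthalpy_pos hmin
  refine ⟨by positivity, min t t', hmin, ?_⟩
  have mono : ∀ s x : ℝ, ∀ y : Space d, min t t' ≤ s → 0 < x →
      √((h (min t t') * x) ^ 2 + ‖y‖ ^ 2) ≤ √((h s * x) ^ 2 + ‖y‖ ^ 2) := by
    intro s x y hs hx
    have := hh.strictMonoOn.monotoneOn hmin (mem_Ioi.2 (hmin.trans_le hs)) hs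
    gcongr
  have h1 := (mono t D m (min_le_left _ _) hD).trans hle
  have h2 := (mono t' D' m' (min_le_right _ _) hD').trans hle'
  rw [sqrt_sq_add_norm_sq_eq_norm] at h1 h2 ⊢
  have hsplit : WithLp.toLp 2 (h (min t t') * (a * D + b * D'), a • m + b • m') =
      a • WithLp.toLp 2 (h (min t t') * D, m) + b • WithLp.toLp 2 (h (min t t') * D', m') := by
    have : (h (min t t') * (a * D + b * D'), a • m + b • m') =
        a • (h (min t t') * D, m) + b • (h (min t t') * D', m') := by
      rw [Prod.smul_mk, Prod.smul_mk, Prod.mk_add_mk, smul_eq_mul, smul_eq_mul, mul_add,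
        mul_left_comm, mul_left_comm _ b]
    rw [this]
    rfl
  rw [hsplit]
  refine (norm_add_le _ _).trans ?_
  rw [norm_smul, norm_smul, Real.norm_of_nonneg ha.le, Real.norm_of_nonneg hb.le]
  gcongr

end Convexity

/-! ### The convex entropy pairs `D ((c - S)⁺)³` -/

section SupportingHyperplanes

variable {E : Type*} [NormedAddCommGroup E] [NormedSpace ℝ E] {s : Set E} {f : E → ℝ}
  {g : E → E →L[ℝ] ℝ}

theorem convexOn_of_supporting (hs : Convex ℝ s)
    (hsub : ∀ x ∈ s, ∀ y ∈ s, f y + g y (x - y) ≤ f x) : ConvexOn ℝ s f := by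
  refine ⟨hs, fun x hx y hy a b ha hb hab => ?_⟩
  have hz := hs hx hy ha hb hab
  have h1 := mul_le_mul_of_nonneg_left (hsub x hx _ hz) ha
  have h2 := mul_le_mul_of_nonneg_left (hsub y hy _ hz) hb
  set z := a • x + b • y with hzdef
  have h3 : a * g z (x - z) + b * g z (y - z) = 0 := by
    have e : a • (x - z) + b • (y - z) = 0 := by
      rw [smul_sub, smul_sub, sub_add_sub_comm, ← hzdef, ← add_smul, hab, one_smul, sub_self]
    rw [← smul_eq_mul, ← smul_eq_mul, ← map_smul, ← map_smul, ← map_add, e, map_zero]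
  have h4 : a * f z + b * f z = f z := by rw [← add_mul, hab, one_mul]
  simp only [smul_eq_mul]
  linarith

/-- A function that has supporting hyperplanes with continuously varying slopes is
differentiable. -/
theorem hasFDerivAt_of_supporting (hs : IsOpen s)
    (hsub : ∀ x ∈ s, ∀ y ∈ s, f y + g y (x - y) ≤ f x) (hg : ContinuousOn g s) {y : E}
    (hy : y ∈ s) : HasFDerivAt f (g y) y := by
  rw [hasFDerivAt_iff_isLittleO, Asymptotics.isLittleO_iff]
  intro c hc
  have hgc := hg.continuousAt (hs.mem_nhds hy)
  filter_upwards [hs.mem_nhds hy, Metric.continuousAt_iff'.1 hgc c hc] with x hx hxc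
  have h1 := hsub x hx y hy
  have h2 := hsub y hy x hx
  have h3 : g x (y - x) = -g x (x - y) := by rw [← map_neg, neg_sub]
  have h4 : (g x - g y) (x - y) = g x (x - y) - g y (x - y) := rfl
  rw [dist_eq_norm] at hxc
  rw [Real.norm_of_nonneg (by linarith)]
  calc f x - f y - g y (x - y) ≤ (g x - g y) (x - y) := by linarith
    _ ≤ ‖g x - g y‖ * ‖x - y‖ := (Real.le_norm_self _).trans (ContinuousLinearMap.le_opNorm _ _)
    _ ≤ c * ‖x - y‖ := by gcongr

theorem contDiffOn_succ_of_supporting (hs : IsOpen s)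
    (hsub : ∀ x ∈ s, ∀ y ∈ s, f y + g y (x - y) ≤ f x) {n : ℕ} (hg : ContDiffOn ℝ n g s) :
    ContDiffOn ℝ (n + 1) f s := by
  have hd : ∀ y ∈ s, HasFDerivAt f (g y) y := fun y hy =>
    hasFDerivAt_of_supporting hs hsub hg.continuousOn hy
  rw [contDiffOn_succ_iff_fderiv_of_isOpen hs]
  refine ⟨fun y hy => (hd y hy).differentiableAt.differentiableWithinAt, by simp, ?_⟩
  exact hg.congr fun y hy => (hd y hy).fderiv

end SupportingHyperplanes

theorem contDiff_max_zero_sq : ContDiff ℝ 1 (fun x : ℝ => max x 0 ^ 2) := by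
  have hsub : ∀ x ∈ (univ : Set ℝ), ∀ y ∈ (univ : Set ℝ), max y 0 ^ 2 +
      ((2 * max y 0) • ContinuousLinearMap.id ℝ ℝ) (x - y) ≤ max x 0 ^ 2 := by
    intro x _ y _
    simp only [smul_apply, ContinuousLinearMap.id_apply, smul_eq_mul]
    rcases le_total y 0 with hy | hy
    · rw [max_eq_right hy]
      simp
    · rw [max_eq_left hy]
      nlinarith [sq_nonneg (max x 0 - y), le_max_left x 0]
  have hg : ContDiffOn ℝ ((0 : ℕ) : WithTop ℕ∞)
      (fun y : ℝ => (2 * max y 0) • ContinuousLinearMap.id ℝ ℝ) univ := by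
    rw [Nat.cast_zero, contDiffOn_zero]
    fun_prop
  have := contDiffOn_succ_of_supporting isOpen_univ hsub hg
  rw [Nat.cast_zero, zero_add] at this
  exact contDiffOn_univ.1 this

theorem max_zero_pow_three (x : ℝ) : max x 0 ^ 3 = x * max x 0 ^ 2 := by
  rcases le_total x 0 with hx | hx
  · rw [max_eq_right hx]
    ring
  · rw [max_eq_left hx]
    ring

theorem max_zero_pow_three_supporting (x y : ℝ) :
    max y 0 ^ 3 + 3 * max y 0 ^ 2 * (x - y) ≤ max x 0 ^ 3 := by
  have hx0 : 0 ≤ max x 0 := le_max_right _ _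
  rcases le_total y 0 with hy | hy
  · rw [max_eq_right hy]
    have := pow_nonneg hx0 3
    simp [this]
  · rw [max_eq_left hy]
    have h1 : 0 ≤ (max x 0 - y) ^ 2 * (max x 0 + 2 * y) := by positivity
    have h2 := mul_le_mul_of_nonneg_left (le_max_left x 0) (by positivity : 0 ≤ 3 * y ^ 2)
    nlinarith

theorem contDiffAt_lorentz {v : Space d} (hv : ‖v‖ < 1) :
    ContDiffAt ℝ 1 (lorentz : Space d → ℝ) v := by
  have h1 : 0 < 1 - ‖v‖ ^ 2 := by nlinarith [norm_nonneg v]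
  exact ((contDiffAt_const.sub (contDiff_id.norm_sq ℝ).contDiffAt).sqrt h1.ne').inv
    (Real.sqrt_pos.2 h1).ne'

theorem contDiffAt_temperature {V : State d} (hV : V ∈ primAdmissible d) :
    ContDiffAt ℝ 1 (fun V : State d => V.2.2 / V.1) V :=
  contDiff_snd.snd.contDiffAt.div contDiff_fst.contDiffAt hV.1.ne'

theorem IsSyngeType.contDiffAt_primEntropy (hh : IsSyngeType h) {V : State d}
    (hV : V ∈ primAdmissible d) : ContDiffAt ℝ 1 (primEntropy h) V := by
  have hθ : 0 < V.2.2 / V.1 := div_pos hV.2.2 hV.1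
  exact (contDiff_fst.contDiffAt.log hV.1.ne').neg.add
    (ContDiffAt.comp V (hh.contDiffOn_thermalEntropy.contDiffAt (Ioi_mem_nhds hθ))
      (contDiffAt_temperature hV))

theorem IsSyngeType.contDiffAt_entropyGradient (hh : IsSyngeType h) {V : State d}
    (hV : V ∈ primAdmissible d) : ContDiffAt ℝ 1 (entropyGradient h) V := by
  have hθ : 0 < V.2.2 / V.1 := div_pos hV.2.2 hV.1
  have ht := contDiffAt_temperature hV
  have hv : ContDiffAt ℝ 1 (fun V : State d => V.2.1) V := contDiff_snd.fst.contDiffAt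
  refine (((hh.contDiffAt_primEntropy hV).sub
    ((ContDiffAt.comp V (hh.contDiffAt_enthalpy hθ) ht).div ht hθ.ne')).smul
      contDiffAt_const).add
    ((((contDiffAt_lorentz hV.2.1).comp V hv).div ht hθ.ne').smul ?_)
  exact (contDiffAt_const.sub
    (((innerSL ℝ).contDiff.contDiffAt.comp V hv).clm_comp contDiffAt_const)).clm_comp
    contDiffAt_const

/-- The differential of the entropy density `D S` at an admissible conservative state. -/
noncomputable def consEntropyGradient (h : ℝ → ℝ) (U : State d) : State d →L[ℝ] ℝ :=
  entropyGradient h (consToPrim h U)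

theorem consEntropyGradient_apply (h : ℝ → ℝ) (U a : State d) :
    consEntropyGradient h U a = (specificEntropy h U -
        h ((consToPrim h U).2.2 / (consToPrim h U).1) /
          ((consToPrim h U).2.2 / (consToPrim h U).1)) * a.1
      + lorentz (consToPrim h U).2.1 / ((consToPrim h U).2.2 / (consToPrim h U).1) *
        (a.2.2 - inner ℝ (consToPrim h U).2.1 a.2.1) :=
  entropyGradient_apply h _ a

theorem IsSyngeType.contDiffOn_specificEntropy (hh : IsSyngeType h) :
    ContDiffOn ℝ 1 (specificEntropy h) (admissible d h) := fun U hU =>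
  (ContDiffAt.comp U (hh.contDiffAt_primEntropy (consToPrim_mem hU))
    (hh.contDiffAt_consToPrim hU)).contDiffWithinAt

theorem IsSyngeType.contDiffOn_consEntropyGradient (hh : IsSyngeType h) :
    ContDiffOn ℝ 1 (consEntropyGradient h) (admissible d h) := fun U hU =>
  (ContDiffAt.comp U (hh.contDiffAt_entropyGradient (consToPrim_mem hU))
    (hh.contDiffAt_consToPrim hU)).contDiffWithinAt

theorem consEntropyGradient_self {U : State d} (hU : U ∈ admissible d h) :
    U.1 + consEntropyGradient h U U = U.1 * specificEntropy h U := by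
  have := entropyGradient_self (h := h) (consToPrim_mem hU)
  rw [primToCons_consToPrim hU] at this
  exact this

theorem IsSyngeType.entropy_le (hh : IsSyngeType h) {U W : State d}
    (hU : U ∈ admissible d h) (hW : W ∈ admissible d h) :
    U.1 * specificEntropy h U ≤ W.1 + consEntropyGradient h W U := by
  have := entropy_le_tangent hh (consToPrim_mem hU) (consToPrim_mem hW)
  rw [primToCons_consToPrim hU, primToCons_consToPrim hW] at this
  exact this

theorem density_pos {U : State d} (hU : U ∈ admissible d h) : 0 < U.1 := by
  obtain ⟨V, hV, rfl⟩ := hU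
  exact mul_pos hV.1 (lorentz_pos hV.2.1)

/-- The entropy `D ((c - S)⁺)³`. It is nonnegative, and vanishes exactly where `S ≥ c`. -/
noncomputable def cutoffEntropy (h : ℝ → ℝ) (c : ℝ) (U : State d) : ℝ :=
  U.1 * max (c - specificEntropy h U) 0 ^ 3

/-- The flux `η vᵢ` of the entropy `η = D ((c - S)⁺)³`. -/
noncomputable def cutoffFlux (h : ℝ → ℝ) (c : ℝ) (i : Fin d) (U : State d) : ℝ :=
  cutoffEntropy h c U * (consToPrim h U).2.1 i

/-- The differential of `D ((c - S)⁺)³`. -/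
noncomputable def cutoffGradient (h : ℝ → ℝ) (c : ℝ) (U : State d) : State d →L[ℝ] ℝ :=
  (max (c - specificEntropy h U) 0 ^ 3 + 3 * max (c - specificEntropy h U) 0 ^ 2 *
      specificEntropy h U) • ContinuousLinearMap.fst ℝ ℝ (Space d × ℝ)
    - (3 * max (c - specificEntropy h U) 0 ^ 2) • consEntropyGradient h U

/-- The entropy `D Z(S)`, with `Z` convex and nonincreasing, inherits supporting hyperplanes from
the concave function `D S`. -/
theorem IsSyngeType.cutoffEntropy_supporting (hh : IsSyngeType h) (c : ℝ) {U W : State d}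
    (hU : U ∈ admissible d h) (hW : W ∈ admissible d h) :
    cutoffEntropy h c W + cutoffGradient h c W (U - W) ≤ cutoffEntropy h c U := by
  have h1 := hh.entropy_le hU hW
  have h2 := consEntropyGradient_self hW
  have h3 := mul_le_mul_of_nonneg_left
    (max_zero_pow_three_supporting (c - specificEntropy h U) (c - specificEntropy h W))
    (density_pos hU).le
  have h4 : 0 ≤ 3 * max (c - specificEntropy h W) 0 ^ 2 := by positivity
  have h5 := mul_le_mul_of_nonneg_left h1 h4
  simp only [cutoffEntropy, cutoffGradient, sub_apply,
    smul_apply, ContinuousLinearMap.coe_fst', smul_eq_mul, map_sub]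
  rw [← sub_eq_iff_eq_add'.2 h2.symm]
  linarith

theorem IsSyngeType.contDiffOn_cutoffGradient (hh : IsSyngeType h) (c : ℝ) :
    ContDiffOn ℝ 1 (cutoffGradient h c) (admissible d h) := by
  have hS := hh.contDiffOn_specificEntropy (d := d)
  have hcS : ContDiffOn ℝ 1 (fun U : State d => c - specificEntropy h U) (admissible d h) :=
    contDiffOn_const.sub hS
  have h2 : ContDiffOn ℝ 1 (fun U : State d => max (c - specificEntropy h U) 0 ^ 2)
      (admissible d h) := contDiff_max_zero_sq.comp_contDiffOn hcS
  have h3 : ContDiffOn ℝ 1 (fun U : State d => max (c - specificEntropy h U) 0 ^ 3)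
      (admissible d h) := (hcS.mul h2).congr fun U _ => max_zero_pow_three _
  exact ((h3.add ((contDiffOn_const.mul h2).mul hS)).smul contDiffOn_const).sub
    ((contDiffOn_const.mul h2).smul hh.contDiffOn_consEntropyGradient)

theorem IsSyngeType.hasFDerivAt_cutoffEntropy (hh : IsSyngeType h) (c : ℝ) {U : State d}
    (hU : U ∈ admissible d h) : HasFDerivAt (cutoffEntropy h c) (cutoffGradient h c U) U :=
  hasFDerivAt_of_supporting hh.isOpen_admissible
    (fun _ hx _ hy => hh.cutoffEntropy_supporting c hx hy)
    (hh.contDiffOn_cutoffGradient c).continuousOn hU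

theorem IsSyngeType.contDiffOn_cutoffEntropy (hh : IsSyngeType h) (c : ℝ) :
    ContDiffOn ℝ 2 (cutoffEntropy h c) (admissible d h) := by
  have := contDiffOn_succ_of_supporting (n := 1) hh.isOpen_admissible
    (fun x hx y hy => hh.cutoffEntropy_supporting (d := d) c hx hy)
    (by exact_mod_cast hh.contDiffOn_cutoffGradient c)
  rwa [Nat.cast_one, one_add_one_eq_two] at this

theorem IsSyngeType.contDiffAt_velocity (hh : IsSyngeType h) (i : Fin d) {U : State d}
    (hU : U ∈ admissible d h) : ContDiffAt ℝ 1 (fun U => (consToPrim h U).2.1 i) U :=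
  (EuclideanSpace.proj (𝕜 := ℝ) i).contDiff.contDiffAt.comp U
    (contDiff_snd.fst.contDiffAt.comp U (hh.contDiffAt_consToPrim hU))

theorem IsSyngeType.contDiffAt_pressure (hh : IsSyngeType h) {U : State d}
    (hU : U ∈ admissible d h) : ContDiffAt ℝ 1 (fun U => (consToPrim h U).2.2) U :=
  contDiff_snd.snd.contDiffAt.comp U (hh.contDiffAt_consToPrim hU)

theorem momentum_eq {U : State d} (hU : U ∈ admissible d h) :
    U.2.1 = (U.2.2 + (consToPrim h U).2.2) • (consToPrim h U).2.1 := by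
  have h1 := primToCons_consToPrim hU
  have h2 : U.2.1 = (primToCons h (consToPrim h U)).2.1 := by rw [h1]
  have h3 : U.2.2 = (primToCons h (consToPrim h U)).2.2 := by rw [h1]
  rw [h2, h3]
  simp only [primToCons, sub_add_cancel]

/-- The rest-frame identity `h D = γ (E + p) (1 - |v|²)`. -/
theorem enthalpy_mul_density_eq {U : State d} (hU : U ∈ admissible d h) :
    h ((consToPrim h U).2.2 / (consToPrim h U).1) * U.1 =
      lorentz (consToPrim h U).2.1 *
        ((U.2.2 + (consToPrim h U).2.2) * (1 - ‖(consToPrim h U).2.1‖ ^ 2)) := by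
  have h1 := primToCons_consToPrim hU
  have h2 : U.1 = (primToCons h (consToPrim h U)).1 := by rw [h1]
  have h3 : U.2.2 = (primToCons h (consToPrim h U)).2.2 := by rw [h1]
  have h4 := lorentz_sq_mul (consToPrim_mem hU).2.1
  rw [h2, h3]
  simp only [primToCons, sub_add_cancel]
  linear_combination -((consToPrim h U).1 * h ((consToPrim h U).2.2 / (consToPrim h U).1) *
    lorentz (consToPrim h U).2.1) * h4

/-- The compatibility condition for the entropy `D ((c - S)⁺)³`. Differentiating
`mᵢ = vᵢ (E + p)` eliminates `dmᵢ`, and all terms then cancel by `enthalpy_mul_density_eq`. -/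
theorem IsSyngeType.fderiv_cutoffFlux (hh : IsSyngeType h) (c : ℝ) (i : Fin d) {U : State d}
    (hU : U ∈ admissible d h) :
    fderiv ℝ (cutoffFlux h c i) U =
      (fderiv ℝ (cutoffEntropy h c) U).comp (fderiv ℝ (flux h i) U) := by
  have hη := hh.hasFDerivAt_cutoffEntropy c hU
  have hv := ((hh.contDiffAt_velocity i hU).differentiableAt one_ne_zero).hasFDerivAt
  have hp := ((hh.contDiffAt_pressure hU).differentiableAt one_ne_zero).hasFDerivAt
  have hm : HasFDerivAt (fun U : State d => U.2.1) ((ContinuousLinearMap.fst ℝ (Space d) ℝ).comp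
      (ContinuousLinearMap.snd ℝ ℝ (Space d × ℝ))) U := hasFDerivAt_snd.fst
  have hE : HasFDerivAt (fun U : State d => U.2.2) ((ContinuousLinearMap.snd ℝ (Space d) ℝ).comp
      (ContinuousLinearMap.snd ℝ ℝ (Space d × ℝ))) U := hasFDerivAt_snd.snd
  have hmi := (EuclideanSpace.proj i : Space d →L[ℝ] ℝ).hasFDerivAt.comp U hm
  have hF : HasFDerivAt (flux h i) _ U :=
    (hasFDerivAt_fst.mul hv).prodMk
      (((hv.smul hm).add (hp.smul_const (EuclideanSpace.single i (1 : ℝ)))).prodMk hmi)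
  have hmi' : HasFDerivAt (fun U : State d => U.2.1 i) _ U :=
    ((hE.add hp).mul hv).congr_of_eventuallyEq (by
      filter_upwards [hh.admissible_mem_nhds hU] with W hW
      conv_lhs => rw [momentum_eq hW]
      simp)
  have hdm := hmi.unique hmi'
  have hq : HasFDerivAt (cutoffFlux h c i) _ U := hη.mul hv
  rw [hη.fderiv, hF.fderiv, hq.fderiv]
  have hkey := enthalpy_mul_density_eq hU
  have hmU := momentum_eq hU
  have hθ : (consToPrim h U).2.2 / (consToPrim h U).1 ≠ 0 :=
    (div_pos (consToPrim_mem hU).2.2 (consToPrim_mem hU).1).ne'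
  refine ContinuousLinearMap.ext fun a => ?_
  have hda := congrArg (fun L : State d →L[ℝ] ℝ => L a) hdm
  simp only [add_apply, smul_apply, smul_eq_mul,
    ContinuousLinearMap.comp_apply, ContinuousLinearMap.coe_fst', ContinuousLinearMap.coe_snd',
    ContinuousLinearMap.prod_apply, ContinuousLinearMap.smulRight_apply, cutoffGradient,
    sub_apply, consEntropyGradient_apply, inner_add_right, inner_smul_right,
    EuclideanSpace.inner_single_right, PiLp.proj_apply, cutoffEntropy, Pi.add_apply,
    one_mul, conj_trivial] at hda ⊢
  have hvm : inner ℝ (consToPrim h U).2.1 U.2.1 =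
      (U.2.2 + (consToPrim h U).2.2) * ‖(consToPrim h U).2.1‖ ^ 2 := by
    conv_lhs => rw [hmU]
    rw [inner_smul_right, real_inner_self_eq_norm_sq]
  rw [hvm, hda]
  generalize (fderiv ℝ (fun U => (consToPrim h U).2.1.ofLp i) U) a = dv
  generalize (fderiv ℝ (fun U => (consToPrim h U).2.2) U) a = dp
  generalize h ((consToPrim h U).2.2 / (consToPrim h U).1) = H at *
  generalize (consToPrim h U).2.2 / (consToPrim h U).1 = θ at *
  generalize lorentz (consToPrim h U).2.1 = γ at *
  generalize ‖(consToPrim h U).2.1‖ ^ 2 = v2 at *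
  generalize max (c - specificEntropy h U) 0 = z at *
  field_simp
  linear_combination (-3 * z ^ 2 * dv) * hkey

theorem IsSyngeType.isConvexEntropyPair (hh : IsSyngeType h) (c : ℝ) :
    IsConvexEntropyPair (d := d) h (cutoffEntropy h c) (cutoffFlux h c) where
  contDiffOn_entropy := hh.contDiffOn_cutoffEntropy c
  convexOn := convexOn_of_supporting hh.convex_admissible
    fun _ hx _ hy => hh.cutoffEntropy_supporting c hx hy
  contDiffOn_flux i := ((hh.contDiffOn_cutoffEntropy c).of_le one_le_two).mul
    fun _ hU => (hh.contDiffAt_velocity i hU).contDiffWithinAt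
  compat i _ hU := hh.fderiv_cutoffFlux c i hU

/-! ### The minimum principle on space-time -/

/-- A test function supported in a backward cone, truncated below `t = 0`. Its level sets for
`t ≥ 0` are spacelike: they move inwards with unit speed, and the smooth substitute `√(1 + |x|²)`
of `|x|` has a gradient shorter than `1`. -/
noncomputable def coneTest (R : ℝ) (z : ℝ × Space d) : ℝ :=
  Real.smoothTransition (z.1 + 1) * expNegInvGlue (R - √(1 + ‖z.2‖ ^ 2) - z.1)

theorem one_add_norm_sq_pos (x : Space d) : 0 < 1 + ‖x‖ ^ 2 := by positivity

theorem coneTest_nonneg (R : ℝ) (z : ℝ × Space d) : 0 ≤ coneTest R z :=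
  mul_nonneg (Real.smoothTransition.nonneg _) (expNegInvGlue.nonneg _)

theorem isTestFunction_coneTest (R : ℝ) : IsTestFunction (coneTest (d := d) R) := by
  constructor
  · have h1 : ContDiff ℝ ∞ (fun z : ℝ × Space d => √(1 + ‖z.2‖ ^ 2)) :=
      (contDiff_const.add (contDiff_snd.norm_sq ℝ)).sqrt fun z => (one_add_norm_sq_pos z.2).ne'
    exact (Real.smoothTransition.contDiff.comp (contDiff_fst.add contDiff_const)).mul
      (expNegInvGlue.contDiff.comp ((contDiff_const.sub h1).sub contDiff_fst))
  · refine HasCompactSupport.intro (K := Icc (-1) R ×ˢ Metric.closedBall (0 : Space d) (R + 1))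
      (isCompact_Icc.prod (isCompact_closedBall _ _)) fun z hz => ?_
    by_contra hne
    rw [coneTest, mul_eq_zero, not_or, Real.smoothTransition.zero_iff_nonpos,
      expNegInvGlue.zero_iff_nonpos, not_le, not_le] at hne
    have h1 : ‖z.2‖ ≤ √(1 + ‖z.2‖ ^ 2) := Real.le_sqrt_of_sq_le (by linarith)
    have h2 := norm_nonneg z.2
    refine hz ⟨⟨by linarith, by linarith⟩, ?_⟩
    rw [mem_closedBall_zero_iff]
    linarith

theorem hasDerivAt_expNegInvGlue (y : ℝ) :
    HasDerivAt expNegInvGlue (y⁻¹ ^ 2 * expNegInvGlue y) y := by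
  have := expNegInvGlue.hasDerivAt_polynomial_eval_inv_mul 1 y
  simpa using this

theorem fderiv_coneTest (R : ℝ) {z : ℝ × Space d} (hz : 0 < z.1) (a : ℝ) (b : Space d) :
    fderiv ℝ (coneTest R) z (a, b) =
      -((R - √(1 + ‖z.2‖ ^ 2) - z.1)⁻¹ ^ 2 * expNegInvGlue (R - √(1 + ‖z.2‖ ^ 2) - z.1)) *
        (a + inner ℝ z.2 b / √(1 + ‖z.2‖ ^ 2)) := by
  have h1 : HasFDerivAt (fun z : ℝ × Space d => √(1 + ‖z.2‖ ^ 2)) _ z :=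
    ((hasFDerivAt_snd.norm_sq).const_add 1).sqrt (one_add_norm_sq_pos z.2).ne'
  have h2 := (hasDerivAt_expNegInvGlue (R - √(1 + ‖z.2‖ ^ 2) - z.1)).comp_hasFDerivAt z
    ((h1.const_sub R).sub hasFDerivAt_fst)
  have h3 : HasFDerivAt (coneTest R) _ z := h2.congr_of_eventuallyEq (by
    filter_upwards [continuousAt_fst.eventually_mem (Ioi_mem_nhds hz)] with w hw
    rw [coneTest, Real.smoothTransition.one_of_one_le (by linarith [mem_Ioi.1 hw]), one_mul]
    rfl)
  rw [h3.fderiv]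
  simp
  ring

/-- The transport operator `∂ₜ + v · ∇` applied to the test function of the cone. -/
theorem transport_coneTest (R : ℝ) {z : ℝ × Space d} (hz : 0 < z.1) (v : Space d) (η : ℝ) :
    dt (coneTest R) z * η + ∑ i, dx i (coneTest R) z * (η * v i) =
      -((R - √(1 + ‖z.2‖ ^ 2) - z.1)⁻¹ ^ 2 * expNegInvGlue (R - √(1 + ‖z.2‖ ^ 2) - z.1)) *
        (1 + inner ℝ z.2 v / √(1 + ‖z.2‖ ^ 2)) * η := by
  have hsum : ∑ i, dx i (coneTest R) z * (η * v i) =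
      fderiv ℝ (coneTest R) z ((0 : ℝ), v) * η := by
    have hv : ((0 : ℝ), v) = ∑ i, v i • ((0 : ℝ), EuclideanSpace.single i (1 : ℝ)) := by
      refine Prod.ext (by simp [Prod.fst_sum]) ?_
      rw [Prod.snd_sum]
      ext j
      simp [Finset.sum_apply, Pi.single_apply]
    rw [hv, map_sum, Finset.sum_mul]
    refine Finset.sum_congr rfl fun i _ => ?_
    rw [map_smul, smul_eq_mul, dx]
    ring
  rw [hsum, dt, fderiv_coneTest R hz, fderiv_coneTest R hz, inner_zero_right]
  ring

theorem one_add_inner_div_pos (x : Space d) {v : Space d} (hv : ‖v‖ < 1) :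
    0 < 1 + inner ℝ x v / √(1 + ‖x‖ ^ 2) := by
  have hs := Real.sqrt_pos.2 (one_add_norm_sq_pos x)
  have h1 : ‖x‖ < √(1 + ‖x‖ ^ 2) := Real.lt_sqrt_of_sq_lt (by linarith)
  have h2 := neg_le_of_abs_le (abs_real_inner_le_norm x v)
  have h3 : ‖x‖ * ‖v‖ ≤ ‖x‖ * 1 := by gcongr
  have h4 : 1 + inner ℝ x v / √(1 + ‖x‖ ^ 2) = (√(1 + ‖x‖ ^ 2) + inner ℝ x v) / √(1 + ‖x‖ ^ 2) := by
    rw [add_div, div_self hs.ne']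
  rw [h4]
  exact div_pos (by linarith) hs

theorem volume_restrict_halfSpace (d : ℕ) : (volume.restrict (halfSpace d)) =
    (volume.restrict (Ioi (0 : ℝ))).prod (volume : Measure (Space d)) := by
  rw [halfSpace, Measure.volume_eq_prod, ← Measure.prod_restrict, Measure.restrict_univ,
    Measure.restrict_congr_set (Ioi_ae_eq_Ici (a := (0 : ℝ)))]

theorem ae_halfSpace_pos (d : ℕ) : ∀ᵐ z ∂(volume.restrict (halfSpace d)), 0 < z.1 := by
  rw [volume_restrict_halfSpace]
  exact Measure.quasiMeasurePreserving_fst.ae (ae_restrict_mem measurableSet_Ioi)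

theorem isClosed_halfSpace (d : ℕ) : IsClosed (halfSpace d) := isClosed_Ici.prod isClosed_univ

theorem IsTestFunction.integrable_fderiv_apply_mul {φ : ℝ × Space d → ℝ} (hφ : IsTestFunction φ)
    (w : ℝ × Space d) {f : ℝ × Space d → ℝ} (hf : LocallyIntegrableOn f (halfSpace d)) :
    Integrable (fun z => fderiv ℝ φ z w * f z) (volume.restrict (halfSpace d)) := by
  have hc : Continuous (fun z => fderiv ℝ φ z w) :=
    (hφ.1.continuous_fderiv (by simp)).clm_apply continuous_const
  have hs : HasCompactSupport (fun z => fderiv ℝ φ z w) := hφ.2.fderiv_apply (𝕜 := ℝ) w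
  exact ((locallyIntegrableOn_iff_locallyIntegrable_restrict
    (isClosed_halfSpace d)).1 hf).integrable_smul_left_of_hasCompactSupport hc hs

theorem cutoffEntropy_nonneg (c : ℝ) {U : State d} (hU : U ∈ admissible d h) :
    0 ≤ cutoffEntropy h c U :=
  mul_nonneg (density_pos hU).le (pow_nonneg (le_max_right _ _) 3)

theorem cutoffEntropy_eq_zero_iff (c : ℝ) {U : State d} (hU : U ∈ admissible d h) :
    cutoffEntropy h c U = 0 ↔ c ≤ specificEntropy h U := by
  rw [cutoffEntropy, mul_eq_zero, or_iff_right (density_pos hU).ne', pow_eq_zero_iff three_ne_zero,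
    max_eq_right_iff, sub_nonpos]

/-- The minimum principle on space-time. Tested with `coneTest`, the inequality for the entropy
`D ((c - S)⁺)³`, which vanishes initially, has an integrand of one sign. -/
theorem IsEntropySolution.ae_le_specificEntropy (hh : IsSyngeType h)
    {U : ℝ → Space d → State d} (hU : IsEntropySolution h U) {c : ℝ}
    (hc : ∀ᵐ x, c ≤ specificEntropy h (U 0 x)) :
    ∀ᵐ z ∂(volume.restrict (halfSpace d)), c ≤ specificEntropy h (U z.1 z.2) := by
  have hpair := hh.isConvexEntropyPair (d := d) c
  obtain ⟨hlη, hlq, -⟩ := hU.locallyIntegrable_entropy _ _ hpair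
  have hinit : ∀ᵐ x, cutoffEntropy h c (U 0 x) = 0 := by
    filter_upwards [hc, hU.mem_admissible_zero] with x hx hxU
    exact (cutoffEntropy_eq_zero_iff c hxU).2 hx
  have hcone : ∀ R : ℕ, ∀ᵐ z ∂(volume.restrict (halfSpace d)),
      0 < R - √(1 + ‖z.2‖ ^ 2) - z.1 → c ≤ specificEntropy h (U z.1 z.2) := by
    intro R
    have hφ := isTestFunction_coneTest (d := d) R
    set f : ℝ × Space d → ℝ := fun z => dt (coneTest R) z * cutoffEntropy h c (U z.1 z.2) +
      ∑ i, dx i (coneTest R) z * cutoffFlux h c i (U z.1 z.2) with hf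
    have hfint : Integrable f (volume.restrict (halfSpace d)) :=
      (hφ.integrable_fderiv_apply_mul _ hlη).add
        (integrable_finsetSum _ fun i _ => hφ.integrable_fderiv_apply_mul _ (hlq i))
    have hfeq : ∀ᵐ z ∂(volume.restrict (halfSpace d)), f z =
        -((R - √(1 + ‖z.2‖ ^ 2) - z.1)⁻¹ ^ 2 * expNegInvGlue (R - √(1 + ‖z.2‖ ^ 2) - z.1)) *
        (1 + inner ℝ z.2 (consToPrim h (U z.1 z.2)).2.1 / √(1 + ‖z.2‖ ^ 2)) *
          cutoffEntropy h c (U z.1 z.2) := by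
      filter_upwards [ae_halfSpace_pos d] with z hz
      exact transport_coneTest R hz _ _
    have hnonneg : 0 ≤ᵐ[volume.restrict (halfSpace d)] fun z => -f z := by
      filter_upwards [hfeq, hU.mem_admissible] with z hz hzU
      have h1 := one_add_inner_div_pos z.2 (consToPrim_mem hzU).2.1
      have h2 := cutoffEntropy_nonneg c hzU
      have h3 := expNegInvGlue.nonneg (R - √(1 + ‖z.2‖ ^ 2) - z.1)
      rw [Pi.zero_apply, hz, neg_mul, neg_mul, neg_neg]
      positivity
    have hineq := hU.entropy_inequality _ _ hpair _ hφ (coneTest_nonneg _)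
    have hzero : ∫ x, coneTest R (0, x) * cutoffEntropy h c (U 0 x) = 0 := by
      refine integral_eq_zero_of_ae ?_
      filter_upwards [hinit] with x hx
      rw [hx, mul_zero, Pi.zero_apply]
    rw [hzero, add_zero] at hineq
    have hint : ∫ z in halfSpace d, -f z = 0 := by
      refine le_antisymm ?_ (integral_nonneg_of_ae hnonneg)
      rw [integral_neg]
      exact neg_nonpos.2 hineq
    have hae := (integral_eq_zero_iff_of_nonneg_ae hnonneg hfint.neg).1 hint
    filter_upwards [hae, hfeq, hU.mem_admissible] with z hz0 hz hzU hy
    have h1 := one_add_inner_div_pos z.2 (consToPrim_mem hzU).2.1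
    have h3 := expNegInvGlue.pos_of_pos hy
    rw [Pi.zero_apply, neg_eq_zero, hz] at hz0
    have h4 := pow_pos (inv_pos.2 hy) 2
    exact (cutoffEntropy_eq_zero_iff c hzU).1
      ((mul_eq_zero.1 hz0).resolve_left
        (mul_ne_zero (neg_ne_zero.2 (mul_pos h4 h3).ne') h1.ne'))
  filter_upwards [ae_all_iff.2 hcone] with z hz
  obtain ⟨R, hR⟩ := exists_nat_gt (√(1 + ‖z.2‖ ^ 2) + z.1)
  exact hz R (by linarith)

/-! ### Times of weak continuity -/

/-- A locally integrable function that is nonnegative as a distribution is nonnegative almost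
everywhere. -/
theorem ae_nonneg_of_forall_integral_mul_nonneg {g : Space d → ℝ} (hg : LocallyIntegrable g)
    (hpos : ∀ ψ : Space d → ℝ, ContDiff ℝ ∞ ψ → HasCompactSupport ψ → (∀ x, 0 ≤ ψ x) →
      0 ≤ ∫ x, ψ x * g x) : ∀ᵐ x, 0 ≤ g x := by
  let φ : ℕ → ContDiffBump (0 : Space d) := fun n =>
    ⟨1 / ((n : ℝ) + 1), 2 * (1 / ((n : ℝ) + 1)), by positivity,
      by linarith [(by positivity : 0 < 1 / ((n : ℝ) + 1))]⟩
  have hlim : Tendsto (fun n => (φ n).rOut) atTop (𝓝 0) := by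
    have := (tendsto_one_div_add_atTop_nhds_zero_nat (𝕜 := ℝ)).const_mul 2
    rwa [mul_zero] at this
  have hconv := ContDiffBump.ae_convolution_tendsto_right_of_locallyIntegrable (φ := φ) (K := 2)
    (μ := volume) hlim (Eventually.of_forall fun n => le_rfl) hg
  filter_upwards [hconv] with x hx
  refine ge_of_tendsto' hx fun n => ?_
  rw [convolution_eq_swap]
  simp only [ContinuousLinearMap.lsmul_apply, smul_eq_mul]
  refine hpos (fun t => (φ n).normed volume (x - t))
    ((φ n).contDiff_normed.comp (contDiff_const.sub contDiff_id)) ?_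
    fun t => (φ n).nonneg_normed _
  exact (φ n).hasCompactSupport_normed.comp_homeomorph (Homeomorph.subLeft x)

/-- Almost every time slice of a locally integrable function on the half space can be tested with
a given compactly supported function. -/
theorem ae_integrable_smul_slice {U : ℝ → Space d → State d}
    (hU : LocallyIntegrableOn (fun z : ℝ × Space d => U z.1 z.2) (halfSpace d))
    {ψ : Space d → ℝ} (hψ : Continuous ψ) (hψs : HasCompactSupport ψ) (T : ℝ) :
    ∀ᵐ s ∂(volume.restrict (Ioi (0 : ℝ))), |s| < T → Integrable (fun x => ψ x • U s x) := by
  have hs : HasCompactSupport (fun z : ℝ × Space d => max (T - |z.1|) 0 * ψ z.2) := by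
    refine HasCompactSupport.intro (K := Icc (-T) T ×ˢ tsupport ψ)
      (isCompact_Icc.prod hψs) fun z hz => ?_
    by_contra hne
    rw [mul_eq_zero, not_or] at hne
    have h1 : 0 < T - |z.1| := by
      by_contra hle
      exact hne.1 (max_eq_right (not_lt.1 hle))
    exact hz ⟨abs_le.1 (by linarith), subset_tsupport _ hne.2⟩
  have hint := ((locallyIntegrableOn_iff_locallyIntegrable_restrict
    (isClosed_halfSpace d)).1 hU).integrable_smul_left_of_hasCompactSupport
      (g := fun z : ℝ × Space d => max (T - |z.1|) 0 * ψ z.2) (by fun_prop) hs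
  rw [volume_restrict_halfSpace] at hint
  filter_upwards [hint.prod_right_ae] with s hs hsT
  have hpos : 0 < max (T - |s|) 0 := lt_max_of_lt_left (by linarith)
  refine (hs.smul (max (T - |s|) 0)⁻¹).congr (Eventually.of_forall fun x => ?_)
  simp only [Pi.smul_apply, smul_smul]
  rw [inv_mul_cancel_left₀ hpos.ne']

theorem integral_mul_const_add_apply {ψ : Space d → ℝ} (hψ : Continuous ψ)
    (hψs : HasCompactSupport ψ) {V : Space d → State d} (hV : Integrable (fun x => ψ x • V x))
    (a : ℝ) (L : State d →L[ℝ] ℝ) :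
    ∫ x, ψ x * (a + L (V x)) = a * (∫ x, ψ x) + L (∫ x, ψ x • V x) := by
  rw [← L.integral_comp_comm hV, ← integral_const_mul, ← integral_add
    ((hψ.integrable_of_hasCompactSupport hψs).const_mul a) (L.integrable_comp hV)]
  refine integral_congr_ae (Eventually.of_forall fun x => ?_)
  simp only [map_smul, smul_eq_mul]
  ring

/-- The lower entropy bound passes to every time of weak continuity: in `𝒢` it defines a convex
set, the intersection of the half spaces `D S ≥ c D` with `D S` replaced by one of its tangent
planes, and each half space is a linear condition that survives weak limits. -/
theorem IsWeaklyContinuousAt.ae_le_specificEntropy (hh : IsSyngeType h)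
    {U : ℝ → Space d → State d}
    (hU : LocallyIntegrableOn (fun z : ℝ × Space d => U z.1 z.2) (halfSpace d)) {c : ℝ}
    (hae : ∀ᵐ s ∂(volume.restrict (Ioi (0 : ℝ))), ∀ᵐ x,
      U s x ∈ admissible d h ∧ c ≤ specificEntropy h (U s x))
    {t : ℝ} (ht : 0 < t) (hw : IsWeaklyContinuousAt h U t) :
    ∀ᵐ x, c ≤ specificEntropy h (U t x) := by
  have htangent : ∀ W ∈ admissible d h, ∀ᵐ x, 0 ≤ W.1 +
      (consEntropyGradient h W - c • ContinuousLinearMap.fst ℝ ℝ (Space d × ℝ)) (U t x) := by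
    intro W hW
    set L := consEntropyGradient h W - c • ContinuousLinearMap.fst ℝ ℝ (Space d × ℝ) with hL
    have hLi : LocallyIntegrable (fun x => L (U t x)) := fun x => by
      obtain ⟨s, hs, hi⟩ := hw.locallyIntegrable x
      exact ⟨s, hs, L.integrable_comp hi⟩
    refine ae_nonneg_of_forall_integral_mul_nonneg ((locallyIntegrable_const W.1).add hLi)
      fun ψ hψ hψs hψ0 => ?_
    have hlim := (L.continuous.tendsto _).comp (hw.tendsto ψ hψ hψs)
    have hlim' := hlim.const_add (W.1 * ∫ x, ψ x)
    have hgood : ∀ᵐ s : ℝ, s ∈ Ioi (0 : ℝ) → |s| < t + 1 →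
        0 ≤ W.1 * (∫ x, ψ x) + L (∫ x, ψ x • U s x) := by
      rw [← ae_restrict_iff' measurableSet_Ioi]
      filter_upwards [hae, ae_integrable_smul_slice hU hψ.continuous hψs (t + 1)] with s hs hsi hst
      rw [← integral_mul_const_add_apply hψ.continuous hψs (hsi hst)]
      refine integral_nonneg_of_ae ?_
      filter_upwards [hs] with x hx
      refine mul_nonneg (hψ0 x) ?_
      have h1 := hh.entropy_le hx.1 hW
      have h2 := mul_le_mul_of_nonneg_left hx.2 (density_pos hx.1).le
      simp only [hL, sub_apply, smul_apply, ContinuousLinearMap.coe_fst', smul_eq_mul]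
      linarith
    have hfreq : ∃ᶠ s in 𝓝 t, 0 ≤ W.1 * (∫ x, ψ x) + L (∫ x, ψ x • U s x) := by
      have hd := mem_closure_iff_frequently.1 (Measure.dense_of_ae hgood t)
      have habs : ∀ᶠ s in 𝓝 t, |s| < t + 1 :=
        continuous_abs.continuousAt.eventually_lt continuousAt_const
          (by rw [abs_of_pos ht]; linarith)
      exact (hd.and_eventually ((eventually_gt_nhds ht).and habs)).mono
        fun s hs => hs.1 hs.2.1 hs.2.2
    have hnonneg := ge_of_tendsto_of_frequently hlim' hfreq
    have hti : Integrable (fun x => ψ x • U t x) :=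
      hw.locallyIntegrable.integrable_smul_left_of_hasCompactSupport hψ.continuous hψs
    have heq := integral_mul_const_add_apply hψ.continuous hψs hti W.1 L
    exact hnonneg.trans_eq heq.symm
  -- Countably many tangent planes suffice, by continuity in the point of tangency.
  obtain ⟨Q, hQc, hQd⟩ := TopologicalSpace.exists_countable_dense (admissible d h)
  have hall := (ae_ball_iff hQc).2 fun W (_ : W ∈ Q) => htangent W.1 W.2
  filter_upwards [hall, hw.mem_admissible] with x hx hxU
  have hcont : Continuous fun W : admissible d h => W.1.1 +
      (consEntropyGradient h W.1 - c • ContinuousLinearMap.fst ℝ ℝ (Space d × ℝ)) (U t x) :=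
    (continuous_fst.comp continuous_subtype_val).add
      ((hh.contDiffOn_consEntropyGradient.continuousOn.domRestrict.sub
        continuous_const).clm_apply continuous_const)
  have hclosed := isClosed_le (continuous_const (y := (0 : ℝ))) hcont
  have hmem : (⟨U t x, hxU⟩ : admissible d h) ∈ closure Q := hQd _
  have hfin : 0 ≤ (U t x).1 + (consEntropyGradient h (U t x) -
      c • ContinuousLinearMap.fst ℝ ℝ (Space d × ℝ)) (U t x) :=
    closure_minimal (fun W hW => hx W hW) hclosed hmem
  have hself := consEntropyGradient_self hxU
  simp only [sub_apply, smul_apply, ContinuousLinearMap.coe_fst', smul_eq_mul] at hfin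
  refine le_of_mul_le_mul_left ?_ (density_pos hxU)
  linarith

theorem IsEntropySolution.ae_ae_le_specificEntropy (hh : IsSyngeType h) {U : ℝ → Space d → State d}
    (hU : IsEntropySolution h U) {c : ℝ} (hc : ∀ᵐ x, c ≤ specificEntropy h (U 0 x)) :
    ∀ᵐ s ∂(volume.restrict (Ioi (0 : ℝ))), ∀ᵐ x,
      U s x ∈ admissible d h ∧ c ≤ specificEntropy h (U s x) := by
  have h1 := hU.mem_admissible.and (hU.ae_le_specificEntropy hh hc)
  rw [volume_restrict_halfSpace] at h1
  exact Measure.ae_ae_of_ae_prod h1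

end RelEuler

theorem theorem2p4 (d : ℕ) (h : ℝ → ℝ) (hh : RelEuler.IsSyngeType h)
    (U : ℝ → RelEuler.Space d → RelEuler.State d) (hU : RelEuler.IsEntropySolution h U) :
    (∀ᵐ t ∂(volume.restrict (Ioi (0 : ℝ))), ∀ᵐ x : RelEuler.Space d,
      essInf (fun y : RelEuler.Space d => (RelEuler.specificEntropy h (U 0 y) : EReal)) volume
        ≤ (RelEuler.specificEntropy h (U t x) : EReal)) ∧
    (∀ t : ℝ, 0 < t → RelEuler.IsWeaklyContinuousAt h U t → ∀ᵐ x : RelEuler.Space d,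
      essInf (fun y : RelEuler.Space d => (RelEuler.specificEntropy h (U 0 y) : EReal)) volume
        ≤ (RelEuler.specificEntropy h (U t x) : EReal)) := by
  have hess := ae_essInf_le
    (f := fun y : RelEuler.Space d => (RelEuler.specificEntropy h (U 0 y) : EReal))
    (μ := volume)
  generalize essInf (fun y : RelEuler.Space d => (RelEuler.specificEntropy h (U 0 y) : EReal))
    volume = e at hess ⊢
  induction e with
  | bot => simp
  | top =>
    -- The entropy is real-valued, so that its essential infimum is not `⊤`.
    obtain ⟨x, hx⟩ := hess.exists
    exact absurd (top_le_iff.1 hx) (EReal.coe_ne_top _)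
  | coe c =>
    simp only [EReal.coe_le_coe_iff] at hess ⊢
    have hae := hU.ae_ae_le_specificEntropy hh hess
    refine ⟨?_, fun t ht hw => hw.ae_le_specificEntropy hh hU.locallyIntegrable hae ht⟩
    filter_upwards [hae] with t ht
    filter_upwards [ht] with x hx using hx.2
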